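/- Let $n,m,s,\ell$ be natural numbers with $m,\ell\ge 1$, and let $f,h_1,\dots,h_m,p_1,\dots,p_s,g_1,\dots,g_\ell\in\mathbb R[x]=\mathbb R[x_1,\dots,x_n]$, where $g_1=R-\|x\|^2=R-\sum_i x_i^2$ for some $R>0$. Let $$X=\{x\in\mathbb R^n\mid p_1(x)=\dots=p_s(x)=0,\ g_1(x)\ge 0,\dots,g_\ell(x)\ge 0\},$$ which is compact because of the ball constraint $g_1\ge0$. Suppose that one of the following two conditions holds. (i) $\ell=1$; $\{x\in\mathbb R^n\mid p_1(x)=\dots=p_s(x)=0\}\subset\{x\mid R-\|x\|^2>0\}$; the ideal $I=(p_1,\dots,p_s)$ is real radical, i.e. $I=\{k\in\mathbb R[x]\mid k^{2a}+\sigma\in I\text{ for some integer }a\ge1\text{ and some sum of squares }\sigma\in\mathbb R[x]\}$; and $p_1,\dots,p_s$ form a Gröbner basis of $I$ with respect to the graded lexicographic order with $x_1>\dots>x_n$, i.e. the leading term of every nonzero $k\in I$ is divisible by the leading term of some $p_l$. (ii) There are no equations (every $p_l$ is zero, or $s=0$), and $X$ has nonempty interior in $\mathbb R^n$. Let $$K=\Big\{\Big(\int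 h_1\,d\mu,\dots,\int h_m\,d\mu\Big)\ \Big|\ \mu \text{ a finite nonnegative Borel measure on }\mathbb R^n\text{ supported on }X\Big\}\subset\mathbb R^m,$$ and assume that $h_1\equiv1$ and that $b\in\mathbb R^m$ satisfies $b_1>0$ and lies in the relative interior of $K$ (its interior within its affine hull). For a polynomial $k$ put $t_k=\lceil \deg(k)/2\rceil$, with $t_0=0$ for the zero polynomial. Let $t_{\min}$ be the maximum of the numbers $t_{g_j}$, $t_{p_l}$, $t_{h_i}$ and $t_f$. Let $\Sigma[x]_{d}$ be the set of polynomials of degree at most $d$ that are sums of squares of polynomials, and for $t\ge t_{\min}$ let $$\mathrm{QM}_{2t}(\mathbf g)=\Big\{\sigma_0+\sum_{j=1}^{\ell}\sigma_jg_j\ \Big|\ \sigma_0\in\Sigma[x]_{2t},\ \sigma_j\in\Sigma[x]_{2(t-t_{g_j})}\Big\},\qquad \langle\mathbf p\rangle_{2t}=\Big\{\sum_{l=1}^s k_lp_l\ \Big|\ k_l\in\mathbb R[x],\ \deg(k_lp_l)\le 2t\Big\}.$$ Then for every $t\ge t_{\min}$ the program $$\sup_{\lambda\in\mathbb R^m}\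 \sum_{i=1}^m b_i\lambda_i\quad\text{subject to}\quad f-\sum_{i=1}^m\lambda_ih_i\in \mathrm{QM}_{2t}(\mathbf g)+\langle\mathbf p\rangle_{2t}$$ attains its optimal value: it has a feasible point $\lambda^*$ with $\sum_i b_i\lambda_i\le\sum_i b_i\lambda_i^*$ for every feasible $\lambda$. -/

import Mathlib

open MvPolynomial MeasureTheory
open scoped Pointwise

noncomputable section

namespace GMP

/-- Polynomials in `n` variables with real coefficients. -/
abbrev Poly (n : ℕ) : Type := MvPolynomial (Fin n) ℝ

/-- `t_k = ⌈deg k / 2⌉`. -/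
def halfDeg {n : ℕ} (k : Poly n) : ℕ := (k.totalDegree + 1) / 2

/-- The ball polynomial `R - ‖x‖² = R - (x₁² + ⋯ + xₙ²)`. -/
def ballPoly (n : ℕ) (R : ℝ) : Poly n := C R - ∑ i, X i ^ 2

/-- The real vanishing set `{x ∈ ℝⁿ | p₁(x) = ⋯ = pₛ(x) = 0}`. -/
def realVariety {n s : ℕ} (p : Fin s → Poly n) : Set (Fin n → ℝ) :=
  {x | ∀ l, eval x (p l) = 0}

/-- The basic closed semialgebraic set
`{x ∈ ℝⁿ | p₁(x) = ⋯ = pₛ(x) = 0, g₁(x) ≥ 0, …, g_ℓ(x) ≥ 0}`. -/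
def semialgSet {n s ℓ : ℕ} (p : Fin s → Poly n) (g : Fin ℓ → Poly n) : Set (Fin n → ℝ) :=
  {x | (∀ l, eval x (p l) = 0) ∧ ∀ j, 0 ≤ eval x (g j)}

/-- The ideal `I(p) = (p₁, …, pₛ)`. -/
def idealOf {n s : ℕ} (p : Fin s → Poly n) : Ideal (Poly n) := Ideal.span (Set.range p)

/-- `I` equals its real radical
`{k | k ^ (2a) + σ ∈ I for some positive integer a and some sum of squares σ}`. -/
def IsRealRadical {n : ℕ} (I : Ideal (Poly n)) : Prop :=
  (I : Set (Poly n)) = {k | ∃ a : ℕ, 0 < a ∧ ∃ σ : Poly n, IsSumSq σ ∧ k ^ (2 * a) + σ ∈ I}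

/-- `p₁, …, pₛ` is a Gröbner basis of `I(p)` for the graded lexicographic order with
`x₁ > x₂ > ⋯ > xₙ`: the leading term of every nonzero element of `I(p)` is divisible by the
leading term of some `p_l`. -/
def IsGrlexGroebner {n s : ℕ} (p : Fin s → Poly n) : Prop :=
  ∀ k ∈ idealOf p, k ≠ 0 →
    ∃ l, MonomialOrder.degLex.leadingTerm (p l) ∣ MonomialOrder.degLex.leadingTerm k

/-- The moment cone
`K = {(∫ h₁ dμ, …, ∫ hₘ dμ) | μ a finite nonnegative Borel measure supported on X}`. -/
def momentCone {n m : ℕ} (X : Set (Fin n → ℝ)) (h : Fin m → Poly n) : Set (Fin m → ℝ) :=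
  {b | ∃ μ : Measure (Fin n → ℝ), IsFiniteMeasure μ ∧ μ Xᶜ = 0 ∧
    ∀ i, b i = ∫ x, eval x (h i) ∂μ}

/-- The sums of squares of degree at most `d`. -/
def sosDeg (n d : ℕ) : Set (Poly n) := {σ | IsSumSq σ ∧ σ.totalDegree ≤ d}

/-- The truncated quadratic module
`QM(g)_{2t} = {σ₀ + ∑ⱼ σⱼ gⱼ | σ₀ ∈ Σ[x]_{2t}, σⱼ ∈ Σ[x]_{2(t - t_{gⱼ})}}`
(used for `t ≥ max_j t_{gⱼ}` only). -/
def truncQM {n ℓ : ℕ} (g : Fin ℓ → Poly n) (t : ℕ) : Set (Poly n) :=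
  {q | ∃ σ₀ ∈ sosDeg n (2 * t), ∃ σ : Fin ℓ → Poly n,
    (∀ j, σ j ∈ sosDeg n (2 * (t - halfDeg (g j)))) ∧ q = σ₀ + ∑ j, σ j * g j}

/-- The truncated ideal `⟨p⟩_{2t} = {∑ₗ kₗ pₗ | deg (kₗ pₗ) ≤ 2t}`. -/
def truncIdeal {n s : ℕ} (p : Fin s → Poly n) (t : ℕ) : Set (Poly n) :=
  {q | ∃ k : Fin s → Poly n, (∀ l, (k l * p l).totalDegree ≤ 2 * t) ∧ q = ∑ l, k l * p l}

/-- The minimal order `t_min`: the maximum of the half-degrees `⌈deg / 2⌉` of all the data. -/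
def tMin {n m s ℓ : ℕ} (p : Fin s → Poly n) (g : Fin ℓ → Poly n) (h : Fin m → Poly n)
    (f : Poly n) : ℕ :=
  (Finset.univ.sup fun j => halfDeg (g j)) ⊔ (Finset.univ.sup fun l => halfDeg (p l)) ⊔
    (Finset.univ.sup fun i => halfDeg (h i)) ⊔ halfDeg f

/-- The feasible set of the strengthening of order `t`:
all `λ ∈ ℝᵐ` with `f - ∑ᵢ λᵢ hᵢ ∈ QM(g)_{2t} + ⟨p⟩_{2t}`. -/
def strFeasible {n m s ℓ : ℕ} (p : Fin s → Poly n) (g : Fin ℓ → Poly n) (h : Fin m → Poly n)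
    (f : Poly n) (t : ℕ) : Set (Fin m → ℝ) :=
  {lam | f - ∑ i, C (lam i) * h i ∈ truncQM g t + truncIdeal p t}

end GMP

end

/-! Sums of squares are encoded by positive semidefinite Gram matrices, so the program maximizes a
linear functional over a closed convex cone (a free `λ` together with Gram matrices) cut by an
affine subspace. The maximum is attained once a feasible point exists and every recession direction
either strictly lowers the objective or keeps it and is reversible
(`Conic.exists_max_of_recession`).

Everything is read modulo `I = (p₁, …, pₛ)`. A recession direction consists of `λ` and sums of
squares `σⱼ` with `∑ λᵢhᵢ + σ₀ + ∑ σⱼgⱼ ∈ I`. Hence `∑ λᵢhᵢ ≤ 0` on `X`, and integration gives `∑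
bᵢλᵢ ≤ 0`. In case of equality `∑ λᵢhᵢ` vanishes on `X`, because `b` can be moved inside the moment
cone away from the moments of any Dirac mass. Then `σ₀` and every `σⱼgⱼ` vanish on `X`. If `I`
contains all polynomials vanishing on `X`, each `q` whose square enters `σⱼ` satisfies `q gⱼ ∈ I`;
Gram matrices written in a basis modulo `{q | q gⱼ ∈ I}` are therefore zero, and the direction `(λ,
0)` is reversible. Feasibility comes from the ball constraint: some `f + N` lies in the truncated
quadratic module, and `h₁ = 1` absorbs the constant.

So two facts about `I` suffice (`GMP.exists_isMaxOn`): it contains every polynomial vanishing on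
`X`, and its elements of degree at most `2t` lie in the truncated ideal. Both are easy when `I = 0`
and `X` has interior points. Otherwise `X` is the whole real variety, the first fact is the real
Nullstellensatz, and the second is division by a Gröbner basis for a graded order.

The Nullstellensatz rests on Artin–Schreier theory. If `k ∉ I`, an ideal above `I` that is maximal
among those avoiding all `k^(2a) + σ` is prime with formally real residue field. This field embeds
into an ordered field with the intermediate value property, where the `p_l` have a common zero with
`k ≠ 0`. `RealAlg.exists_zero_of_extension` brings such a zero down to `ℝ`, one coordinate at a
time, through ultrapowers. -/

section

open Polynomial

universe u

set_option linter.unusedSectionVars false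
set_option linter.overlappingInstances false

/-! ### Roots and signs of polynomials over ordered fields with the intermediate value property. -/

namespace RealAlg

/-- Polynomials over the ordered field `N` satisfy the intermediate value theorem. -/
def PolyIVT (N : Type*) [Field N] [LinearOrder N] : Prop :=
  ∀ (f : N[X]) (a b : N), a < b → f.eval a * f.eval b < 0 → ∃ c, a < c ∧ c < b ∧ f.eval c = 0

section Basic

variable {R : Type*} [Field R] [LinearOrder R] [IsStrictOrderedRing R]

theorem mul_pos_of_no_root (hR : PolyIVT R) {h : R[X]} {a b x y : R}
    (hno : ∀ c, a ≤ c → c ≤ b → h.eval c ≠ 0) (hx : a ≤ x) (hx' : x ≤ b) (hy : a ≤ y)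
    (hy' : y ≤ b) : 0 < h.eval x * h.eval y := by
  by_contra hcon
  have hne : h.eval x * h.eval y ≠ 0 := mul_ne_zero (hno x hx hx') (hno y hy hy')
  have hlt : h.eval x * h.eval y < 0 := lt_of_le_of_ne (not_lt.1 hcon) hne
  rcases lt_trichotomy x y with hxy | hxy | hxy
  · obtain ⟨c, h1, h2, h3⟩ := hR h x y hxy hlt
    exact hno c (hx.trans h1.le) (h2.le.trans hy') h3
  · subst hxy
    exact absurd hlt (not_lt.2 (mul_self_nonneg _))
  · obtain ⟨c, h1, h2, h3⟩ := hR h y x hxy (by rwa [mul_comm])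
    exact hno c (hy.trans h1.le) (h2.le.trans hx') h3

/-- If `ζ` is a simple root of `f` and the only root in `[a, b]`, then the sign of `f` on `[a, b]`
tells the side of `ζ`. -/
theorem eval_mul_neg_iff_lt_root (hR : PolyIVT R) {f : R[X]} {a b ζ : R} (ha : a < ζ) (hb : ζ < b)
    (hζ : f.eval ζ = 0) (hd : f.derivative.eval ζ ≠ 0)
    (huniq : ∀ c, a ≤ c → c ≤ b → f.eval c = 0 → c = ζ) {x : R} (hx : a ≤ x) (hx' : x ≤ b) :
    f.eval x * f.eval b < 0 ↔ x < ζ := by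
  obtain ⟨h, rfl⟩ := dvd_iff_isRoot.2 (show f.IsRoot ζ from hζ)
  have hhζ : h.eval ζ ≠ 0 := by simpa using hd
  have hno : ∀ c, a ≤ c → c ≤ b → h.eval c ≠ 0 := by
    intro c h1 h2 h3
    have := huniq c h1 h2 (by simp [h3])
    subst this
    exact hhζ h3
  have hpos := mul_pos_of_no_root hR hno hx hx' (ha.trans hb).le le_rfl
  have hb' : 0 < b - ζ := sub_pos.2 hb
  have key : Polynomial.eval x ((Polynomial.X - Polynomial.C ζ) * h) * Polynomial.eval b ((Polynomial.X - Polynomial.C ζ) * h) =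
      (x - ζ) * ((b - ζ) * (h.eval x * h.eval b)) := by
    simp; ring
  rw [key, mul_neg_iff]
  have := mul_pos hb' hpos
  constructor
  · rintro (h1 | h1)
    · exact absurd h1.2 (not_lt.2 this.le)
    · exact sub_neg.1 h1.1
  · intro h1
    exact Or.inr ⟨sub_neg.2 h1, this⟩

/-- Rolle's theorem for simple roots. -/
theorem exists_derivative_root (hR : PolyIVT R) {f : R[X]} {a b : R} (hab : a < b)
    (ha : f.eval a = 0) (hb : f.eval b = 0)
    (hsimple : ∀ c, f.eval c = 0 → f.derivative.eval c ≠ 0) :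
    ∃ c, a < c ∧ c < b ∧ f.derivative.eval c = 0 := by
  have hf0 : f ≠ 0 := by
    rintro rfl
    exact hsimple a ha (by simp)
  set S := f.roots.toFinset.filter (fun c => a < c) with hS
  have hbS : b ∈ S := by
    simp [hS, hf0, hab, hb]
  obtain ⟨b', hb'S, hmin⟩ := S.exists_min_image id ⟨b, hbS⟩
  have hb'1 : f.eval b' = 0 := by
    have := (Finset.mem_filter.1 hb'S).1
    simpa [hf0] using this
  have hab' : a < b' := (Finset.mem_filter.1 hb'S).2
  have hb'b : b' ≤ b := hmin b hbS
  have hnone : ∀ c, a < c → c < b' → f.eval c ≠ 0 := by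
    intro c h1 h2 h3
    have : c ∈ S := by simp [hS, hf0, h1, h3]
    exact absurd (hmin c this) (not_le.2 h2)
  obtain ⟨h1, rfl⟩ := dvd_iff_isRoot.2 (show f.IsRoot a from ha)
  have h1b : h1.eval b' = 0 := by
    have : (b' - a) * h1.eval b' = 0 := by simpa using hb'1
    exact (mul_eq_zero.1 this).resolve_left (sub_ne_zero.2 hab'.ne')
  obtain ⟨h, rfl⟩ := dvd_iff_isRoot.2 (show h1.IsRoot b' from h1b)
  have hda := hsimple a ha
  have hdb := hsimple b' hb'1
  have ea : Polynomial.eval a (derivative ((Polynomial.X - Polynomial.C a) * ((Polynomial.X - Polynomial.C b') * h))) = (a - b') * h.eval a := by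
    simp
  have eb : Polynomial.eval b' (derivative ((Polynomial.X - Polynomial.C a) * ((Polynomial.X - Polynomial.C b') * h))) = (b' - a) * h.eval b' := by
    simp
  rw [ea] at hda
  rw [eb] at hdb
  have hno : ∀ c, a ≤ c → c ≤ b' → h.eval c ≠ 0 := by
    intro c h1 h2 h3
    rcases h1.eq_or_lt with rfl | h1
    · exact hda (by simp [h3])
    rcases h2.eq_or_lt with rfl | h2
    · exact hdb (by simp [h3])
    · exact hnone c h1 h2 (by simp [h3])
  have hpos := mul_pos_of_no_root hR hno le_rfl hab'.le hab'.le le_rfl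
  obtain ⟨c, h1, h2, h3⟩ := hR _ a b' hab' (by
    rw [ea, eb]
    have := mul_pos (mul_pos (sub_pos.2 hab') (sub_pos.2 hab')) hpos
    nlinarith)
  exact ⟨c, h1, h2.trans_le hb'b, h3⟩

/-- A root of a monic polynomial is bounded in terms of its coefficients. -/
theorem lt_of_monic_root {f : R[X]} (hf : f.Monic) {z : R} (hz : f.eval z = 0) :
    |z| < 2 + ∑ i ∈ Finset.range f.natDegree, |f.coeff i| := by
  by_contra hcon
  push Not at hcon
  set s := ∑ i ∈ Finset.range f.natDegree, |f.coeff i| with hs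
  have hs0 : 0 ≤ s := Finset.sum_nonneg fun _ _ => abs_nonneg _
  have h1 : 1 ≤ |z| := by linarith
  rw [eval_eq_sum_range, Finset.sum_range_succ, hf.coeff_natDegree, one_mul] at hz
  have hd : f.natDegree ≠ 0 := by
    intro h0
    rw [h0] at hz
    simp at hz
  obtain ⟨d, hd⟩ := Nat.exists_eq_succ_of_ne_zero hd
  have h2 : |z| ^ f.natDegree ≤ s * |z| ^ d := by
    have h3 : z ^ f.natDegree = -∑ i ∈ Finset.range f.natDegree, f.coeff i * z ^ i := by linarith
    rw [← abs_pow, h3, abs_neg, hs, Finset.sum_mul]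
    refine (Finset.abs_sum_le_sum_abs _ _).trans (Finset.sum_le_sum fun i hi => ?_)
    rw [abs_mul, abs_pow]
    refine mul_le_mul_of_nonneg_left (pow_le_pow_right₀ h1 ?_) (abs_nonneg _)
    have := Finset.mem_range.1 hi
    omega
  rw [hd, pow_succ, mul_comm] at h2
  have h4 : 0 < |z| ^ d := by positivity
  have := le_of_mul_le_mul_right h2 h4
  linarith

end Basic

/-! ### Cuts of a subfield and the signs they determine. -/

section Cut

variable {E R S : Type*} [Field E] [LinearOrder E] [IsStrictOrderedRing E]
  [Field R] [LinearOrder R] [IsStrictOrderedRing R]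
  [Field S] [LinearOrder S] [IsStrictOrderedRing S]

/-- Finitely many elements do not determine a cut: some further element lies on the same side. -/
theorem exists_same_cut (L : Set E) (hL : ∀ x ∈ L, ∀ y ∉ L, x < y) (T : Finset E) :
    ∃ c, ∀ d ∈ T, d ≠ c ∧ (d < c ↔ d ∈ L) := by
  classical
  obtain ⟨c, h1, h2⟩ := Order.exists_between_finsets (T.filter (· ∈ L)) (T.filter (· ∉ L))
    (fun x hx y hy => hL x (Finset.mem_filter.1 hx).2 y (Finset.mem_filter.1 hy).2)
  refine ⟨c, fun d hd => ?_⟩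
  by_cases hdL : d ∈ L
  · have := h1 d (Finset.mem_filter.2 ⟨hd, hdL⟩)
    exact ⟨this.ne, by simp [this, hdL]⟩
  · have := h2 d (Finset.mem_filter.2 ⟨hd, hdL⟩)
    exact ⟨this.ne', by simp [hdL, this.le]⟩

theorem cut_lt {i : E →+* R} (hi : StrictMono i) {ζ : R} :
    ∀ x ∈ {e | i e < ζ}, ∀ y ∉ {e | i e < ζ}, x < y := by
  intro x hx y hy
  exact hi.lt_iff_lt.1 (lt_of_lt_of_le hx (not_lt.1 hy))

/-- If all roots of `q` come from `E` and no root separates `c` and `ζ`, then `q` has the same sign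
at `c` and at `ζ`. -/
theorem eval₂_pos_iff_of_cut (hR : PolyIVT R) {i : E →+* R} (hi : StrictMono i) {q : E[X]}
    {T : Finset E} (hq : ∀ z, q.eval₂ i z = 0 → ∃ d ∈ T, i d = z) {ζ : R} (hζ : ζ ∉ Set.range i)
    {c : E} (hc : ∀ d ∈ T, d ≠ c ∧ (d < c ↔ i d < ζ)) :
    0 < q.eval₂ i ζ ↔ 0 < q.eval c := by
  have hqc : q.eval₂ i (i c) = i (q.eval c) := by
    rw [eval₂_at_apply]
  have hpos : 0 < (q.map i).eval ζ * (q.map i).eval (i c) := by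
    have key : ∀ x, min ζ (i c) ≤ x → x ≤ max ζ (i c) → (q.map i).eval x ≠ 0 := by
      intro x h1 h2 h3
      rw [Polynomial.eval_map] at h3
      obtain ⟨d, hd, rfl⟩ := hq x h3
      have hdc := hc d hd
      have hne : i d ≠ ζ := fun h => hζ ⟨d, h⟩
      have hne' : i d ≠ i c := fun h => hdc.1 (hi.injective h)
      rcases min_le_iff.1 h1 with h1 | h1 <;> rcases le_max_iff.1 h2 with h2 | h2
      · exact hne (le_antisymm h2 h1)
      · have h3 := hdc.2.1 (hi.lt_iff_lt.1 (lt_of_le_of_ne h2 hne'))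
        exact absurd h3 (not_lt.2 h1)
      · have h3 := hdc.2.2 (lt_of_le_of_ne h2 hne)
        exact absurd (hi h3) (not_lt.2 h1)
      · exact hne' (le_antisymm h2 h1)
    exact mul_pos_of_no_root hR key (min_le_left _ _) (le_max_left _ _) (min_le_right _ _)
      (le_max_right _ _)
  rw [Polynomial.eval_map, Polynomial.eval_map, hqc] at hpos
  rw [pos_iff_pos_of_mul_pos hpos, ← hi.lt_iff_lt, map_zero]

/-- Same cut, same sign. -/
theorem eval₂_pos_iff_of_same_cut (hR : PolyIVT R) (hS : PolyIVT S) {i : E →+* R} {j : E →+* S}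
    (hi : StrictMono i) (hj : StrictMono j) {q : E[X]} (hq0 : q ≠ 0)
    (hqi : ∀ z, q.eval₂ i z = 0 → z ∈ Set.range i) (hqj : ∀ z, q.eval₂ j z = 0 → z ∈ Set.range j)
    {ζ : R} {ξ : S} (hζ : ζ ∉ Set.range i) (hξ : ξ ∉ Set.range j)
    (hcut : ∀ e, i e < ζ ↔ j e < ξ) :
    0 < q.eval₂ i ζ ↔ 0 < q.eval₂ j ξ := by
  obtain ⟨c, hc⟩ := exists_same_cut {e | i e < ζ} (cut_lt hi) q.roots.toFinset
  rw [eval₂_pos_iff_of_cut hR hi (T := q.roots.toFinset) ?_ hζ hc,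
    eval₂_pos_iff_of_cut hS hj (T := q.roots.toFinset) ?_ hξ ?_]
  · intro z hz
    obtain ⟨d, rfl⟩ := hqj z hz
    refine ⟨d, ?_, rfl⟩
    rw [eval₂_at_apply, map_eq_zero] at hz
    simpa [hq0] using hz
  · intro d hd
    rw [← hcut]
    exact hc d hd
  · intro z hz
    obtain ⟨d, rfl⟩ := hqi z hz
    refine ⟨d, ?_, rfl⟩
    rw [eval₂_at_apply, map_eq_zero] at hz
    simpa [hq0] using hz

/-- In characteristic zero an irreducible polynomial is coprime to its derivative, and the Bézout
identity persists in every extension. -/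
theorem derivative_eval_ne_zero_of_irreducible {K : Type*} [Field K] {G : E[X]}
    (hG : Irreducible G) (k : E →+* K) {c : K} (hc : G.eval₂ k c = 0) :
    (G.map k).derivative.eval c ≠ 0 := by
  intro hc'
  obtain ⟨u, v, huv⟩ := hG.separable.map (f := k)
  have := congrArg (Polynomial.eval c) huv
  simp only [Polynomial.eval_add, Polynomial.eval_mul, hc', eval_one] at this
  rw [Polynomial.eval_map, hc] at this
  simp at this

/-- Between two consecutive roots of the derivative there is at most one root, also after
extending the field. -/
theorem root_unique_of_no_derivative_root (hR : PolyIVT R) {i : E →+* R} (hi : StrictMono i)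
    {G : E[X]} (hG : Irreducible G)
    (hder : ∀ z, G.derivative.eval₂ i z = 0 → z ∈ Set.range i) {a b : E}
    (hno : ∀ d, a < d → d < b → G.derivative.eval d ≠ 0)
    {x y : R} (hx : i a ≤ x) (hx' : x ≤ i b) (hy : i a ≤ y)
    (hy' : y ≤ i b) (hGx : G.eval₂ i x = 0) (hGy : G.eval₂ i y = 0) : x = y := by
  wlog hxy : x < y generalizing x y
  · rcases lt_trichotomy x y with h | h | h
    · exact absurd h hxy
    · exact h
    · exact (this hy hy' hx hx' hGy hGx h).symm
  obtain ⟨c, h1, h2, h3⟩ := exists_derivative_root hR (f := G.map i) hxy (by rwa [Polynomial.eval_map])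
    (by rwa [Polynomial.eval_map])
    (fun c hc => derivative_eval_ne_zero_of_irreducible hG i (by rwa [Polynomial.eval_map] at hc))
  rw [derivative_map, Polynomial.eval_map] at h3
  obtain ⟨d, rfl⟩ := hder c h3
  rw [eval₂_at_apply, map_eq_zero] at h3
  exact absurd h3 (hno d (hi.lt_iff_lt.1 (hx.trans_lt h1)) (hi.lt_iff_lt.1 (h2.trans_le hy')))

/-- An irreducible polynomial with a root in one extension has, under a minimality assumption, a
root with the same cut in the other one. -/
theorem exists_root_same_cut (hR : PolyIVT R) (hS : PolyIVT S) {i : E →+* R} {j : E →+* S}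
    (hi : StrictMono i) (hj : StrictMono j) {G : E[X]} (hG : Irreducible G)
    (hroot : ∀ e, G.eval e ≠ 0)
    (hderi : ∀ z, G.derivative.eval₂ i z = 0 → z ∈ Set.range i)
    (hderj : ∀ z, G.derivative.eval₂ j z = 0 → z ∈ Set.range j) {ζ : R} (hζ : G.eval₂ i ζ = 0) :
    ∃ ξ : S, G.eval₂ j ξ = 0 ∧ ∀ e, i e < ζ ↔ j e < ξ := by
  have hζr : ζ ∉ Set.range i := by
    rintro ⟨e, rfl⟩
    rw [eval₂_at_apply, map_eq_zero] at hζ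
    exact hroot e hζ
  have hd0 : G.derivative ≠ 0 := by
    intro h0
    have := hG.separable
    rw [separable_def, h0, isCoprime_zero_right] at this
    exact hG.not_isUnit this
  -- The root bound is built from the coefficients of `G`, hence lies in `E`. It guarantees that `T`
  -- below has points on both sides of `ζ`.
  obtain ⟨B, hB⟩ : ∃ B : E, |ζ| < i B := by
    set G' := G * Polynomial.C G.leadingCoeff⁻¹ with hG'
    have hm : G'.Monic := monic_mul_leadingCoeff_inv hG.ne_zero
    refine ⟨2 + ∑ k ∈ Finset.range G'.natDegree, |G'.coeff k|, ?_⟩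
    have h := lt_of_monic_root (hm.map i) (z := ζ) (by
      rw [Polynomial.eval_map, hG', Polynomial.eval₂_mul, hζ, zero_mul])
    have habs : ∀ e, i |e| = |i e| := by
      intro e
      rcases le_total 0 e with h | h
      · rw [abs_of_nonneg h, abs_of_nonneg (by simpa using hi.monotone h)]
      · rw [abs_of_nonpos h, abs_of_nonpos (by simpa using hi.monotone h), map_neg]
    simpa [natDegree_map, map_sum, habs, map_ofNat i 2] using h
  rw [abs_lt] at hB
  set T := insert B (insert (-B) G.derivative.roots.toFinset) with hT
  have hmemT : ∀ d, G.derivative.eval d = 0 → d ∈ T := by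
    intro d hd
    simp [hT, hd0, hd]
  obtain ⟨a, haT, hamax⟩ := (T.filter (fun e => i e < ζ)).exists_max_image id
    ⟨-B, by simp [hT, hB.1]⟩
  obtain ⟨b, hbT, hbmin⟩ := (T.filter (fun e => ζ < i e)).exists_min_image id
    ⟨B, by simp [hT, hB.2]⟩
  rw [Finset.mem_filter] at haT hbT
  have hno : ∀ d, a < d → d < b → G.derivative.eval d ≠ 0 := by
    intro d h1 h2 h3
    rcases lt_trichotomy (i d) ζ with h | h | h
    · exact absurd (hamax d (Finset.mem_filter.2 ⟨hmemT d h3, h⟩)) (not_le.2 h1)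
    · exact hζr ⟨d, h⟩
    · exact absurd (hbmin d (Finset.mem_filter.2 ⟨hmemT d h3, h⟩)) (not_le.2 h2)
  have hab : a < b := hi.lt_iff_lt.1 (haT.2.trans hbT.2)
  -- By Rolle, `ζ` is the only root between the neighbours `a` and `b`, so the signs of `G` on `E`
  -- locate it. These signs do not depend on the embedding, which lets the same criterion locate `ξ`
  -- in `S`.
  have hiE : ∀ e, a ≤ e → e ≤ b → (G.eval e * G.eval b < 0 ↔ i e < ζ) := by
    intro e h1 h2
    have := eval_mul_neg_iff_lt_root hR (f := G.map i) haT.2 hbT.2 (by rwa [Polynomial.eval_map])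
      (derivative_eval_ne_zero_of_irreducible hG i hζ) (fun c h1 h2 h3 => root_unique_of_no_derivative_root hR hi hG hderi hno h1 h2 haT.2.le hbT.2.le (by rwa [Polynomial.eval_map] at h3) hζ)
      (hi.monotone h1) (hi.monotone h2)
    rwa [Polynomial.eval_map, Polynomial.eval_map, eval₂_at_apply, eval₂_at_apply, ← map_mul, ← map_zero i,
      hi.lt_iff_lt] at this
  obtain ⟨ξ, h1, h2, h3⟩ := hS (G.map j) (j a) (j b) (hj hab) (by
    rw [Polynomial.eval_map, Polynomial.eval_map, eval₂_at_apply, eval₂_at_apply, ← map_mul, ← map_zero j,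
      hj.lt_iff_lt]
    exact (hiE a le_rfl hab.le).2 haT.2)
  rw [Polynomial.eval_map] at h3
  have hjE : ∀ e, a ≤ e → e ≤ b → (G.eval e * G.eval b < 0 ↔ j e < ξ) := by
    intro e h4 h5
    have := eval_mul_neg_iff_lt_root hS (f := G.map j) h1 h2 (by rwa [Polynomial.eval_map])
      (derivative_eval_ne_zero_of_irreducible hG j h3) (fun c h4 h5 h6 => root_unique_of_no_derivative_root hS hj hG hderj hno h4 h5 h1.le h2.le (by rwa [Polynomial.eval_map] at h6) h3)
      (hj.monotone h4) (hj.monotone h5)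
    rwa [Polynomial.eval_map, Polynomial.eval_map, eval₂_at_apply, eval₂_at_apply, ← map_mul, ← map_zero j,
      hj.lt_iff_lt] at this
  refine ⟨ξ, h3, fun e => ?_⟩
  rcases le_total e a with hea | hea
  · exact ⟨fun _ => (hj.monotone hea).trans_lt h1, fun _ => (hi.monotone hea).trans_lt haT.2⟩
  rcases le_total e b with heb | heb
  · rw [← hiE e hea heb, hjE e hea heb]
  · exact ⟨fun h => absurd h (not_lt.2 (hbT.2.le.trans (hi.monotone heb))),
      fun h => absurd h (not_lt.2 (h2.le.trans (hj.monotone heb)))⟩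

end Cut

end RealAlg

/-! ### Extending order isomorphisms between subrings of two ordered fields. -/

namespace RealAlg

variable {R S : Type*} [Field R] [LinearOrder R] [IsStrictOrderedRing R]
  [Field S] [LinearOrder S] [IsStrictOrderedRing S]

/-- A subring of a product of two ordered fields that is the graph of an order isomorphism. -/
def Consistent (P : Subring (R × S)) : Prop := ∀ p ∈ P, 0 < p.1 ↔ 0 < p.2

theorem Consistent.eq_zero_iff {P : Subring (R × S)} (hP : Consistent P) {p : R × S} (hp : p ∈ P) :
    p.1 = 0 ↔ p.2 = 0 := by
  have h1 := hP p hp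
  have h2 := hP (-p) (neg_mem hp)
  simp only [Prod.fst_neg, Prod.snd_neg, Left.neg_pos_iff] at h2
  constructor
  · intro h
    rw [h] at h1 h2
    exact le_antisymm (not_lt.1 fun h' => lt_irrefl _ (h1.2 h'))
      (not_lt.1 fun h' => lt_irrefl _ (h2.2 h'))
  · intro h
    rw [h] at h1 h2
    exact le_antisymm (not_lt.1 fun h' => lt_irrefl _ (h1.1 h'))
      (not_lt.1 fun h' => lt_irrefl _ (h2.1 h'))

theorem exists_maximal_consistent {P₀ : Subring (R × S)} (h₀ : Consistent P₀) :
    ∃ P, P₀ ≤ P ∧ Maximal Consistent P := by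
  refine zorn_le_nonempty₀ {P : Subring (R × S) | Consistent P} (fun c hc hchain y hy => ?_) P₀ h₀
  refine ⟨sSup c, ?_, fun z hz => le_sSup hz⟩
  intro p hp
  obtain ⟨s, hs, hps⟩ := (Subring.mem_sSup_of_directedOn ⟨y, hy⟩ hchain.directedOn).1 hp
  exact hc hs p hps

/-- The fractions of elements of a consistent subring. -/
def fracSubring (P : Subring (R × S)) (hP : Consistent P) : Subring (R × S) where
  carrier := {x | ∃ p ∈ P, ∃ d ∈ P, d.1 ≠ 0 ∧ x = (p.1 / d.1, p.2 / d.2)}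
  mul_mem' := by
    rintro _ _ ⟨p, hp, d, hd, h, rfl⟩ ⟨p', hp', d', hd', h', rfl⟩
    exact ⟨p * p', mul_mem hp hp', d * d', mul_mem hd hd', mul_ne_zero h h', by
      simp [div_mul_div_comm]⟩
  one_mem' := ⟨1, one_mem _, 1, one_mem _, one_ne_zero, by ext <;> simp⟩
  add_mem' := by
    rintro _ _ ⟨p, hp, d, hd, h, rfl⟩ ⟨p', hp', d', hd', h', rfl⟩
    have h2 : d.2 ≠ 0 := fun h0 => h ((hP.eq_zero_iff hd).2 h0)
    have h2' : d'.2 ≠ 0 := fun h0 => h' ((hP.eq_zero_iff hd').2 h0)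
    exact ⟨p * d' + d * p', add_mem (mul_mem hp hd') (mul_mem hd hp'), d * d', mul_mem hd hd',
      mul_ne_zero h h', by simp [div_add_div _ _ h h', div_add_div _ _ h2 h2']⟩
  zero_mem' := ⟨0, zero_mem _, 1, one_mem _, one_ne_zero, by ext <;> simp⟩
  neg_mem' := by
    rintro _ ⟨p, hp, d, hd, h, rfl⟩
    exact ⟨-p, neg_mem hp, d, hd, h, by simp [neg_div]⟩

/-- A quotient `p / d` has the sign of `p * d`. -/
theorem consistent_fracSubring {P : Subring (R × S)} (hP : Consistent P) :
    Consistent (fracSubring P hP) := by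
  rintro _ ⟨p, hp, d, hd, h, rfl⟩
  have h2 : d.2 ≠ 0 := fun h0 => h ((hP.eq_zero_iff hd).2 h0)
  have key := hP (p * d) (mul_mem hp hd)
  simp only [Prod.fst_mul, Prod.snd_mul] at key
  have e1 : p.1 / d.1 = (p.1 * d.1) / (d.1 * d.1) := by field_simp
  have e2 : p.2 / d.2 = (p.2 * d.2) / (d.2 * d.2) := by field_simp
  have q1 : 0 < d.1 * d.1 := mul_self_pos.2 h
  have q2 : 0 < d.2 * d.2 := mul_self_pos.2 h2
  simp only
  rw [e1, e2, div_pos_iff_of_pos_right q1, div_pos_iff_of_pos_right q2, key]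

theorem le_fracSubring {P : Subring (R × S)} (hP : Consistent P) : P ≤ fracSubring P hP :=
  fun p hp => ⟨p, hp, 1, one_mem _, one_ne_zero, by ext <;> simp⟩

theorem inv_mem_of_maximal {P : Subring (R × S)} (hP : Maximal Consistent P) {p : R × S}
    (hp : p ∈ P) : (p.1⁻¹, p.2⁻¹) ∈ P := by
  by_cases h : p.1 = 0
  · rw [h, (hP.prop.eq_zero_iff hp).1 h, inv_zero, inv_zero]
    exact zero_mem P
  · refine hP.2 (consistent_fracSubring hP.prop) (le_fracSubring hP.prop) ?_
    exact ⟨1, one_mem _, p, hp, h, by ext <;> simp⟩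

/-- A maximal consistent subring is the graph of an embedding of a subfield. -/
theorem exists_subfield_of_maximal {P : Subring (R × S)} (hP : Maximal Consistent P) :
    ∃ (E : Subfield R) (σ : E →+* S), StrictMono σ ∧
      ∀ p : R × S, p ∈ P ↔ ∃ e : E, (e : R) = p.1 ∧ σ e = p.2 := by
  have huniq : ∀ {a : R} {b b' : S}, (a, b) ∈ P → (a, b') ∈ P → b = b' := by
    intro a b b' h h'
    have := (hP.prop.eq_zero_iff (sub_mem h h')).1 (by simp)
    simpa [sub_eq_zero] using this
  let E : Subfield R :=
    { carrier := {a | ∃ b, (a, b) ∈ P}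
      mul_mem' := by
        rintro a a' ⟨b, h⟩ ⟨b', h'⟩
        exact ⟨_, mul_mem h h'⟩
      one_mem' := ⟨1, one_mem P⟩
      add_mem' := by
        rintro a a' ⟨b, h⟩ ⟨b', h'⟩
        exact ⟨_, add_mem h h'⟩
      zero_mem' := ⟨0, zero_mem P⟩
      neg_mem' := by
        rintro a ⟨b, h⟩
        exact ⟨_, neg_mem h⟩
      inv_mem' := by
        rintro a ⟨b, h⟩
        exact ⟨_, inv_mem_of_maximal hP h⟩ }
  have hE : ∀ e : E, ∃ b, ((e : R), b) ∈ P := fun e => e.2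
  choose f hf using hE
  let σ : E →+* S :=
    { toFun := f
      map_one' := huniq (hf 1) (one_mem P)
      map_mul' := fun x y => huniq (hf (x * y)) (mul_mem (hf x) (hf y))
      map_zero' := huniq (hf 0) (zero_mem P)
      map_add' := fun x y => huniq (hf (x + y)) (add_mem (hf x) (hf y)) }
  refine ⟨E, σ, ?_, ?_⟩
  · intro x y hxy
    have := (hP.prop _ (sub_mem (hf y) (hf x))).1 (by simpa using hxy)
    exact sub_pos.1 this
  · rintro ⟨a, b⟩
    constructor
    · intro h
      exact ⟨⟨a, b, h⟩, rfl, huniq (hf _) h⟩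
    · rintro ⟨e, rfl, rfl⟩
      exact hf e

theorem eval₂_prod {E : Type*} [Semiring E] (i : E →+* R) (j : E →+* S) (q : E[X]) (x : R × S) :
    q.eval₂ (i.prod j) x = (q.eval₂ i x.1, q.eval₂ j x.2) := by
  ext
  · exact Polynomial.hom_eval₂ q (i.prod j) (RingHom.fst R S) x
  · exact Polynomial.hom_eval₂ q (i.prod j) (RingHom.snd R S) x

/-- Adjoining `(ζ, ξ)` to `P` yields the image of `E[X]` under evaluation. Agreement of all signs
makes it consistent, so maximality leaves nothing to add. -/
theorem mem_of_maximal {P : Subring (R × S)} (hP : Maximal Consistent P) {E : Subfield R}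
    {σ : E →+* S} (hE : ∀ p : R × S, p ∈ P ↔ ∃ e : E, (e : R) = p.1 ∧ σ e = p.2) {ζ : R} {ξ : S}
    (h : ∀ q : E[X], 0 < q.eval₂ E.subtype ζ ↔ 0 < q.eval₂ σ ξ) : (ζ, ξ) ∈ P := by
  let φ := eval₂RingHom (E.subtype.prod σ) (ζ, ξ)
  have hφ : ∀ q, φ q = (q.eval₂ E.subtype ζ, q.eval₂ σ ξ) := fun q => by
    simp [φ, eval₂_prod]
  refine hP.2 (y := φ.range) ?_ ?_ ?_
  · rintro _ ⟨q, rfl⟩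
    rw [hφ]
    exact h q
  · intro p hp
    obtain ⟨e, h1, h2⟩ := (hE p).1 hp
    refine ⟨Polynomial.C e, ?_⟩
    rw [hφ]
    ext <;> simp [h1, h2]
  · exact ⟨Polynomial.X, by rw [hφ]; simp⟩

/-- An order isomorphism between subrings of fields with the intermediate value property extends to
an embedding of a relatively algebraically closed subfield. -/
theorem exists_algebraicallyClosed_lift (hR : PolyIVT R) (hS : PolyIVT S) {P₀ : Subring (R × S)}
    (h₀ : Consistent P₀) :
    ∃ (E : Subfield R) (σ : E →+* S), StrictMono σ ∧
      (∀ p ∈ P₀, ∃ e : E, (e : R) = p.1 ∧ σ e = p.2) ∧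
      ∀ (z : R) (q : E[X]), q ≠ 0 → q.eval₂ E.subtype z = 0 → z ∈ E := by
  classical
  obtain ⟨P, hP₀, hP⟩ := exists_maximal_consistent h₀
  obtain ⟨E, σ, hσ, hE⟩ := exists_subfield_of_maximal hP
  refine ⟨E, σ, hσ, fun p hp => (hE p).1 (hP₀ hp), ?_⟩
  have hi : StrictMono E.subtype := fun x y h => h
  -- Both fields enter symmetrically. At the least bad degree, every nonzero polynomial of smaller
  -- degree, in particular the derivative of `G` and nonzero remainders modulo `G`, has its roots in
  -- `E` and in the image of `σ` respectively.
  let Bad : ℕ → Prop := fun n => ∃ G : E[X], G ≠ 0 ∧ G.natDegree = n ∧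
    ((∃ z, G.eval₂ E.subtype z = 0 ∧ z ∉ Set.range E.subtype) ∨
      (∃ z, G.eval₂ σ z = 0 ∧ z ∉ Set.range σ))
  by_contra hcon
  push Not at hcon
  obtain ⟨z, q, hq0, hqz, hzE⟩ := hcon
  have hbad : ∃ n, Bad n := ⟨_, q, hq0, rfl, Or.inl ⟨z, hqz, by simpa using hzE⟩⟩
  obtain ⟨G, hG0, hGn, hG⟩ := Nat.find_spec hbad
  have hmin : ∀ q : E[X], q ≠ 0 → q.natDegree < G.natDegree →
      (∀ z, q.eval₂ E.subtype z = 0 → z ∈ Set.range E.subtype) ∧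
      (∀ z, q.eval₂ σ z = 0 → z ∈ Set.range σ) := by
    intro q hq0 hqn
    rw [hGn] at hqn
    have := Nat.find_min hbad hqn
    constructor
    · intro z hz
      by_contra hz'
      exact this ⟨q, hq0, rfl, Or.inl ⟨z, hz, hz'⟩⟩
    · intro z hz
      by_contra hz'
      exact this ⟨q, hq0, rfl, Or.inr ⟨z, hz, hz'⟩⟩
  have hnu : ¬ IsUnit G := by
    intro hu
    obtain ⟨u, hu', rfl⟩ := Polynomial.isUnit_iff.1 hu
    rcases hG with ⟨z, hz, -⟩ | ⟨z, hz, -⟩ <;>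
    · rw [Polynomial.eval₂_C, map_eq_zero] at hz
      exact hu'.ne_zero hz
  have hirr : Irreducible G := by
    refine ⟨hnu, fun {A B} hAB => ?_⟩
    by_contra hcon
    push Not at hcon
    have hA0 : A ≠ 0 := by rintro rfl; simp [hAB] at hG0
    have hB0 : B ≠ 0 := by rintro rfl; simp [hAB] at hG0
    have hdA : A.natDegree ≠ 0 := fun h => hcon.1 (by
      rw [natDegree_eq_zero] at h
      obtain ⟨c, rfl⟩ := h
      exact isUnit_C.2 (IsUnit.mk0 _ (by simpa using hA0)))
    have hdB : B.natDegree ≠ 0 := fun h => hcon.2 (by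
      rw [natDegree_eq_zero] at h
      obtain ⟨c, rfl⟩ := h
      exact isUnit_C.2 (IsUnit.mk0 _ (by simpa using hB0)))
    have hdeg : G.natDegree = A.natDegree + B.natDegree := by rw [hAB, natDegree_mul hA0 hB0]
    have hA := hmin A hA0 (by omega)
    have hB := hmin B hB0 (by omega)
    rcases hG with ⟨z, hz, hz'⟩ | ⟨z, hz, hz'⟩
    · rw [hAB, Polynomial.eval₂_mul, mul_eq_zero] at hz
      exact hz' (hz.elim (hA.1 z) (hB.1 z))
    · rw [hAB, Polynomial.eval₂_mul, mul_eq_zero] at hz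
      exact hz' (hz.elim (hA.2 z) (hB.2 z))
  have hroot : ∀ e, G.eval e ≠ 0 := by
    intro e he
    have h1 : G.natDegree = 1 := natDegree_eq_of_degree_eq_some
      (degree_eq_one_of_irreducible_of_root hirr he)
    obtain ⟨Q, hQ⟩ := dvd_iff_isRoot.2 (show G.IsRoot e from he)
    have hQu : IsUnit Q := (hirr.isUnit_or_isUnit hQ).resolve_left (not_isUnit_X_sub_C e)
    obtain ⟨u, hu, rfl⟩ := Polynomial.isUnit_iff.1 hQu
    rcases hG with ⟨z, hz, hz'⟩ | ⟨z, hz, hz'⟩ <;>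
    · rw [hQ, Polynomial.eval₂_mul, Polynomial.eval₂_C, mul_eq_zero, map_eq_zero] at hz
      have := hz.resolve_right hu.ne_zero
      rw [Polynomial.eval₂_sub, Polynomial.eval₂_X, Polynomial.eval₂_C, sub_eq_zero] at this
      exact hz' ⟨e, this.symm⟩
  have hd0 : G.derivative ≠ 0 := by
    intro h0
    have := hirr.separable
    rw [separable_def, h0, isCoprime_zero_right] at this
    exact hnu this
  have hdn : G.natDegree ≠ 0 := by
    intro h
    rw [natDegree_eq_zero] at h
    obtain ⟨c, rfl⟩ := h
    simp at hd0
  have hder := hmin G.derivative hd0 (natDegree_derivative_lt hdn)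
  obtain ⟨ζ, ξ, hζ, hξ, hcut⟩ : ∃ (ζ : R) (ξ : S), G.eval₂ E.subtype ζ = 0 ∧ G.eval₂ σ ξ = 0 ∧
      ∀ e, E.subtype e < ζ ↔ σ e < ξ := by
    rcases hG with ⟨ζ, hζ, -⟩ | ⟨ξ, hξ, -⟩
    · obtain ⟨ξ, h1, h2⟩ := exists_root_same_cut hR hS hi hσ hirr hroot hder.1 hder.2 hζ
      exact ⟨ζ, ξ, hζ, h1, h2⟩
    · obtain ⟨ζ, h1, h2⟩ := exists_root_same_cut hS hR hσ hi hirr hroot hder.2 hder.1 hξ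
      exact ⟨ζ, ξ, h1, hξ, fun e => (h2 e).symm⟩
  have hζE : ζ ∉ Set.range E.subtype := by
    rintro ⟨e, rfl⟩
    rw [eval₂_at_apply, map_eq_zero] at hζ
    exact hroot e hζ
  have hξE : ξ ∉ Set.range σ := by
    rintro ⟨e, rfl⟩
    rw [eval₂_at_apply, map_eq_zero] at hξ
    exact hroot e hξ
  -- Reduction modulo `G` leaves a polynomial whose roots all come from `E`, so its sign at `ζ` or
  -- `ξ` depends only on the common cut.
  have hmem := mem_of_maximal hP hE (ζ := ζ) (ξ := ξ) (by
    intro q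
    have e1 : q.eval₂ E.subtype ζ = (q % G).eval₂ E.subtype ζ := by
      conv_lhs => rw [← EuclideanDomain.mod_add_div q G]
      rw [Polynomial.eval₂_add, Polynomial.eval₂_mul, hζ, zero_mul, add_zero]
    have e2 : q.eval₂ σ ξ = (q % G).eval₂ σ ξ := by
      conv_lhs => rw [← EuclideanDomain.mod_add_div q G]
      rw [Polynomial.eval₂_add, Polynomial.eval₂_mul, hξ, zero_mul, add_zero]
    rw [e1, e2]
    by_cases hr : q % G = 0
    · simp [hr]
    have hr' := hmin _ hr (natDegree_mod_lt q hdn)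
    exact eval₂_pos_iff_of_same_cut hR hS hi hσ hr hr'.1 hr'.2 hζE hξE hcut)
  obtain ⟨e, he, -⟩ := (hE _).1 hmem
  exact hζE ⟨e, he⟩

end RealAlg

/-! ### Ultrapowers of ordered fields and descent of zeros. -/

namespace RealAlg

/-- The coefficients lift to functions on `ι`, and a root is chosen index by index wherever the sign
change holds, which is almost everywhere along `U`. -/
theorem polyIVT_germ {ι M : Type*} [Field M] [LinearOrder M] [IsStrictOrderedRing M]
    (hM : PolyIVT M) (U : Ultrafilter ι) : PolyIVT ((U : Filter ι).Germ M) := by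
  classical
  intro f a b hab hf
  induction a using Filter.Germ.inductionOn with | _ a
  induction b using Filter.Germ.inductionOn with | _ b
  obtain ⟨F, rfl⟩ := Polynomial.map_surjective (Filter.Germ.coeRingHom (R := M) (U : Filter ι))
    (fun y => Filter.Germ.inductionOn y fun g => ⟨g, rfl⟩) f
  have hev : ∀ u : ι → M, (F.map (Filter.Germ.coeRingHom (U : Filter ι))).eval
      (u : (U : Filter ι).Germ M) =
        ((fun t => (F.map (Pi.evalRingHom (fun _ => M) t)).eval (u t) : ι → M) :
          (U : Filter ι).Germ M) := by
    intro u
    have h1 : (F.map (Filter.Germ.coeRingHom (U : Filter ι))).eval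
        (Filter.Germ.coeRingHom (U : Filter ι) u) =
          Filter.Germ.coeRingHom (U : Filter ι) (F.eval u) := by
      rw [Polynomial.eval_map, eval₂_at_apply]
    have h2 : F.eval u = fun t => (F.map (Pi.evalRingHom (fun _ => M) t)).eval (u t) := by
      funext t
      have : (F.map (Pi.evalRingHom (fun _ => M) t)).eval (Pi.evalRingHom (fun _ => M) t u) =
          Pi.evalRingHom (fun _ => M) t (F.eval u) := by
        rw [Polynomial.eval_map, eval₂_at_apply]
      exact this.symm
    rw [h2] at h1
    exact h1
  rw [hev, hev] at hf
  have h1 : ∀ᶠ t in (U : Filter ι), a t < b t := Filter.Germ.coe_lt.1 hab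
  have h2 : ∀ᶠ t in (U : Filter ι), (F.map (Pi.evalRingHom (fun _ => M) t)).eval (a t) *
      (F.map (Pi.evalRingHom (fun _ => M) t)).eval (b t) < 0 := Filter.Germ.coe_lt.1 hf
  have h3 : ∀ t, ∃ c, (a t < b t → (F.map (Pi.evalRingHom (fun _ => M) t)).eval (a t) *
      (F.map (Pi.evalRingHom (fun _ => M) t)).eval (b t) < 0 →
      a t < c ∧ c < b t ∧ (F.map (Pi.evalRingHom (fun _ => M) t)).eval c = 0) := by
    intro t
    by_cases h : a t < b t ∧ (F.map (Pi.evalRingHom (fun _ => M) t)).eval (a t) *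
      (F.map (Pi.evalRingHom (fun _ => M) t)).eval (b t) < 0
    · obtain ⟨c, hc⟩ := hM _ _ _ h.1 h.2
      exact ⟨c, fun _ _ => hc⟩
    · exact ⟨0, fun h1 h2 => absurd ⟨h1, h2⟩ h⟩
  choose c hc using h3
  refine ⟨(c : (U : Filter ι).Germ M), ?_, ?_, ?_⟩
  · refine Filter.Germ.coe_lt.2 ?_
    filter_upwards [h1, h2] with t h1 h2 using (hc t h1 h2).1
  · refine Filter.Germ.coe_lt.2 ?_
    filter_upwards [h1, h2] with t h1 h2 using (hc t h1 h2).2.1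
  · rw [hev]
    refine Filter.Germ.coe_eq.2 ?_
    filter_upwards [h1, h2] with t h1 h2 using (hc t h1 h2).2.2

variable {M N : Type*} [Field M] [LinearOrder M] [IsStrictOrderedRing M]
  [Field N] [LinearOrder N] [IsStrictOrderedRing N]

/-- A relatively algebraically closed subfield inherits the intermediate value property. -/
theorem PolyIVT.of_algebraicallyClosed (hN : PolyIVT N) {i : M →+* N} (hi : StrictMono i)
    (hac : ∀ (z : N) (q : M[X]), q ≠ 0 → q.eval₂ i z = 0 → z ∈ Set.range i) : PolyIVT M := by
  intro f a b hab hf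
  obtain ⟨c, h1, h2, h3⟩ := hN (f.map i) (i a) (i b) (hi hab) (by
    rwa [Polynomial.eval_map, Polynomial.eval_map, eval₂_at_apply, eval₂_at_apply, ← map_mul, ← map_zero i,
      hi.lt_iff_lt])
  rw [Polynomial.eval_map] at h3
  obtain ⟨d, rfl⟩ := hac c f (by rintro rfl; simp at hf) h3
  rw [eval₂_at_apply, map_eq_zero] at h3
  exact ⟨d, hi.lt_iff_lt.1 h1, hi.lt_iff_lt.1 h2, h3⟩

/-- An element of an extension of `M` is realized, as far as signs of polynomials are concerned,
by the identity germ along an ultrafilter on `M`. -/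
theorem exists_ultrafilter_sign (hN : PolyIVT N) {i : M →+* N} (hi : StrictMono i)
    (hac : ∀ (z : N) (q : M[X]), q ≠ 0 → q.eval₂ i z = 0 → z ∈ Set.range i) {x : N}
    (hx : x ∉ Set.range i) :
    ∃ U : Ultrafilter M, ∀ q : M[X], 0 < q.eval₂ i x → ∀ᶠ a in (U : Filter M), 0 < q.eval a := by
  classical
  -- `T e` consists of the points of `M` strictly on the same side of `e` as `x`. Finitely many such
  -- sets always meet, so some ultrafilter contains them all.
  let T : M → Set M := fun e => {a | e ≠ a ∧ (e < a ↔ i e < x)}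
  have hfip : ∀ F : Finset M, (⋂ e ∈ F, T e).Nonempty := by
    intro F
    obtain ⟨c, hc⟩ := exists_same_cut {e | i e < x} (cut_lt hi) F
    exact ⟨c, Set.mem_iInter₂.2 hc⟩
  have hne : (⨅ F : Finset M, Filter.principal (⋂ e ∈ F, T e)).NeBot := by
    refine Filter.iInf_neBot_of_directed' (fun F F' => ⟨F ∪ F', ?_, ?_⟩)
      (fun F => Filter.principal_neBot_iff.2 (hfip F))
    · exact Filter.principal_mono.2
        (Set.biInter_subset_biInter_left fun _ h => Finset.mem_union_left _ h)
    · exact Filter.principal_mono.2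
        (Set.biInter_subset_biInter_left fun _ h => Finset.mem_union_right _ h)
  refine ⟨@Ultrafilter.of _ _ hne, fun q hq => ?_⟩
  have hbi : (⋂ d ∈ q.roots.toFinset, T d) ∈ (@Ultrafilter.of _ _ hne : Filter M) :=
    (@Ultrafilter.of_le _ _ hne)
      (Filter.mem_iInf_of_mem q.roots.toFinset (Filter.mem_principal_self _))
  filter_upwards [hbi] with a ha
  rw [Set.mem_iInter₂] at ha
  have hq0 : q ≠ 0 := by rintro rfl; simp at hq
  refine (eval₂_pos_iff_of_cut hN hi (T := q.roots.toFinset) ?_ hx ha).1 hq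
  intro z hz
  obtain ⟨d, rfl⟩ := hac z q hq0 hz
  refine ⟨d, ?_, rfl⟩
  rw [eval₂_at_apply, map_eq_zero] at hz
  simpa [hq0] using hz

/-- A finite polynomial system over `M` with a zero in an extension with the intermediate value
property has a zero in `M`, if `M` is relatively algebraically closed. -/
theorem exists_zero_of_extension {N : Type u} [Field N] [LinearOrder N] [IsStrictOrderedRing N]
    (hN : PolyIVT N) (r : ℕ) :
    ∀ (M : Type u) [Field M] [LinearOrder M] [IsStrictOrderedRing M] (i : M →+* N),
      StrictMono i → (∀ (z : N) (q : M[X]), q ≠ 0 → q.eval₂ i z = 0 → z ∈ Set.range i) →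
      ∀ (y : Fin r → N) (S : Finset (MvPolynomial (Fin r) M)),
        (∀ f ∈ S, f.eval₂ i y = 0) → ∃ w : Fin r → M, ∀ f ∈ S, f.eval w = 0 := by
  classical
  induction r with
  | zero =>
    intro M _ _ _ i hi hac y S hS
    refine ⟨Fin.elim0, fun f hf => ?_⟩
    have := hS f hf
    obtain ⟨c, rfl⟩ := MvPolynomial.C_surjective (Fin 0) f
    simpa using this
  | succ r ih =>
    intro M _ _ _ i hi hac y S hS
    by_cases hy : y 0 ∈ Set.range i
    · obtain ⟨a, ha⟩ := hy
      let φ : MvPolynomial (Fin (r + 1)) M →+* MvPolynomial (Fin r) M :=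
        MvPolynomial.eval₂Hom MvPolynomial.C (Fin.cons (MvPolynomial.C a) MvPolynomial.X)
      obtain ⟨w, hw⟩ := ih M i hi hac (Fin.tail y) (S.image φ) (by
        intro f hf
        obtain ⟨f, hfS, rfl⟩ := Finset.mem_image.1 hf
        have h1 : ((MvPolynomial.eval₂Hom i (Fin.tail y)).comp φ) = MvPolynomial.eval₂Hom i y := by
          apply MvPolynomial.ringHom_ext
          · intro c; simp [φ]
          · intro k
            refine Fin.cases ?_ (fun k => ?_) k
            · simp [φ, ha]
            · simp [φ, Fin.tail]
        have := hS f hfS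
        rwa [← MvPolynomial.coe_eval₂Hom, ← h1] at this)
      refine ⟨Fin.cons a w, fun f hf => ?_⟩
      have h1 : ((MvPolynomial.eval w).comp φ) = MvPolynomial.eval (Fin.cons a w) := by
        apply MvPolynomial.ringHom_ext
        · intro c; simp [φ]
        · intro k
          refine Fin.cases ?_ (fun k => ?_) k
          · simp [φ]
          · simp [φ]
      rw [← h1]
      exact hw _ (Finset.mem_image_of_mem φ hf)
    -- Here `y 0` is transcendental over `M`, and `M[y 0]` is order isomorphic to `M[ι]` in the
    -- ultrapower, with `ι` the identity germ. The isomorphism extends to a relatively algebraically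
    -- closed `E` containing `y 0`, over which induction solves for the other coordinates. Its image
    -- under `σ` is represented by functions `g k`, and for almost every `a` the point with first
    -- coordinate `a` and the others `g k a` solves the system in `M`.
    · obtain ⟨U, hU⟩ := exists_ultrafilter_sign hN hi hac hy
      let G := (U : Filter M).Germ M
      let γ : M →+* G := (Filter.Germ.coeRingHom (U : Filter M)).comp (Pi.constRingHom M M)
      let ι : G := ((id : M → M) : (U : Filter M).Germ M)
      have hγ : ∀ q : M[X], q.eval₂ γ ι = ((fun a => q.eval a : M → M) : (U : Filter M).Germ M) := by
        intro q
        have h1 : q.eval₂ γ ι =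
            Filter.Germ.coeRingHom (U : Filter M) (q.eval₂ (Pi.constRingHom M M) id) := by
          rw [Polynomial.hom_eval₂]; rfl
        have h2 : q.eval₂ (Pi.constRingHom M M) id = fun a => q.eval a := by
          funext a
          have := Polynomial.hom_eval₂ q (Pi.constRingHom M M) (Pi.evalRingHom (fun _ => M) a) id
          exact this
        rw [h1, h2]; rfl
      let ψ := eval₂RingHom (i.prod γ) (y 0, ι)
      have hψ : ∀ q, ψ q = (q.eval₂ i (y 0), q.eval₂ γ ι) := fun q => by
        simp [ψ, eval₂_prod]
      have hpos : ∀ q : M[X], 0 < q.eval₂ i (y 0) → 0 < q.eval₂ γ ι := by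
        intro q hq
        rw [hγ]
        exact Filter.Germ.coe_pos.2 (hU q hq)
      have hcons : Consistent ψ.range := by
        rintro _ ⟨q, rfl⟩
        rw [hψ]
        refine ⟨hpos q, fun hq => ?_⟩
        by_contra hcon
        rcases (not_lt.1 hcon).eq_or_lt with h0 | h0
        · by_cases hq0 : q = 0
          · subst hq0; simp at hq
          · exact hy (hac _ q hq0 h0)
        · have := hpos (-q) (by simpa using h0)
          simp only [Polynomial.eval₂_neg, Left.neg_pos_iff] at this
          exact lt_asymm hq this
      have hMivt := hN.of_algebraicallyClosed hi hac
      obtain ⟨E, σ, hσ, hE, hEac⟩ := exists_algebraicallyClosed_lift hN (polyIVT_germ hMivt U) hcons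
      obtain ⟨x, hx, hxι⟩ := hE _ ⟨Polynomial.X, rfl⟩
      have hc : ∀ c : M, ∃ e : E, (e : N) = i c ∧ σ e = γ c := by
        intro c
        obtain ⟨e, h1, h2⟩ := hE _ ⟨Polynomial.C c, rfl⟩
        rw [hψ] at h1 h2
        exact ⟨e, by simpa using h1, by simpa using h2⟩
      rw [hψ] at hx hxι
      simp only [Polynomial.eval₂_X] at hx hxι
      have hic : ∀ c, i c ∈ E := fun c => by
        obtain ⟨e, h, -⟩ := hc c
        rw [← h]; exact e.2
      let κ : M →+* E := i.codRestrict E hic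
      have hσκ : ∀ c, σ (κ c) = γ c := by
        intro c
        obtain ⟨e, h1, h2⟩ := hc c
        rw [← h2]
        congr 1
        exact Subtype.ext h1.symm
      let φ : MvPolynomial (Fin (r + 1)) M →+* MvPolynomial (Fin r) E :=
        MvPolynomial.eval₂Hom (MvPolynomial.C.comp κ) (Fin.cons (MvPolynomial.C x) MvPolynomial.X)
      obtain ⟨w, hw⟩ := ih E E.subtype (fun _ _ h => h)
        (fun z q hq hz => ⟨⟨z, hEac z q hq hz⟩, rfl⟩) (Fin.tail y) (S.image φ) (by
        intro f hf
        obtain ⟨f, hfS, rfl⟩ := Finset.mem_image.1 hf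
        have h1 : ((MvPolynomial.eval₂Hom E.subtype (Fin.tail y)).comp φ) =
            MvPolynomial.eval₂Hom i y := by
          apply MvPolynomial.ringHom_ext
          · intro c; simp [φ]; rfl
          · intro k
            refine Fin.cases ?_ (fun k => ?_) k
            · simp [φ, hx]
            · simp [φ, Fin.tail]
        have := hS f hfS
        rwa [← MvPolynomial.coe_eval₂Hom, ← h1] at this)
      have hex : ∀ k, ∃ g : M → M, ((g : (U : Filter M).Germ M)) = σ (w k) := fun k =>
        Filter.Germ.inductionOn (σ (w k)) fun g => ⟨g, rfl⟩
      choose g hg using hex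
      have hev : ∀ f ∈ S, ∀ᶠ a in (U : Filter M), f.eval (Fin.cons a fun k => g k a) = 0 := by
        intro f hf
        have h1 : σ ((φ f).eval w) = 0 := by
          rw [hw _ (Finset.mem_image_of_mem φ hf), map_zero]
        let θ : MvPolynomial (Fin (r + 1)) M →+* (M → M) :=
          RingHom.pi fun a => MvPolynomial.eval (Fin.cons a fun k => g k a)
        have hθ : ∀ F a, θ F a = F.eval (Fin.cons a fun k => g k a) := fun _ _ => rfl
        have h2 : (σ.comp ((MvPolynomial.eval w).comp φ)) =
            (Filter.Germ.coeRingHom (U : Filter M)).comp θ := by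
          apply MvPolynomial.ringHom_ext
          · intro c
            have : θ (MvPolynomial.C c) = Pi.constRingHom M M c := by
              funext a; simp [hθ]
            rw [RingHom.comp_apply (Filter.Germ.coeRingHom (U : Filter M)) θ, this]
            simp [φ, hσκ, γ]
          · intro k
            refine Fin.cases ?_ (fun k => ?_) k
            · have : θ (MvPolynomial.X 0) = id := by
                funext a; simp [hθ]
              rw [RingHom.comp_apply (Filter.Germ.coeRingHom (U : Filter M)) θ, this]
              simp [φ, hxι, ι]
            · have : θ (MvPolynomial.X k.succ) = g k := by
                funext a; simp [hθ]
              rw [RingHom.comp_apply (Filter.Germ.coeRingHom (U : Filter M)) θ, this]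
              simp [φ, hg]
        have h3 : Filter.Germ.coeRingHom (U : Filter M) (θ f) = 0 := by
          have := congrArg (fun F => F f) h2
          simp only [RingHom.comp_apply] at this
          rw [← this, h1]
        exact Filter.Germ.coe_eq.1 h3
      have hall := (Filter.eventually_all_finset S).2 hev
      obtain ⟨a, ha⟩ := hall.exists
      exact ⟨_, ha⟩

end RealAlg

/-! ### Artin–Schreier theory of formally real fields. -/

namespace RealAlg

theorem isSumSq_map {A B : Type*} [Semiring A] [Semiring B] (φ : A →+* B) {s : A}
    (hs : IsSumSq s) : IsSumSq (φ s) := by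
  induction hs with
  | zero => simp
  | sq_add a _ ih =>
    rw [map_add, map_mul]
    exact ih.sq_add _

/-- A formally real field all of whose simple algebraic extensions fail to be formally real. -/
structure MaximalReal (N : Type*) [Field N] : Prop where
  not_isSumSq : ¬ IsSumSq (-1 : N)
  exists_root : ∀ f : N[X], Irreducible f → ¬ IsSumSq (-1 : AdjoinRoot f) → ∃ z, f.eval z = 0

theorem exists_isSumSq_of_sSup {Ω : Type*} [Field Ω] {c : Set (Subfield Ω)} (hne : c.Nonempty)
    (hdir : DirectedOn (· ≤ ·) c) {s : (sSup c : Subfield Ω)} (hs : IsSumSq s) :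
    ∃ K ∈ c, ∃ y : K, IsSumSq y ∧ (y : Ω) = s := by
  induction hs with
  | zero =>
    obtain ⟨K, hK⟩ := hne
    exact ⟨K, hK, 0, IsSumSq.zero, rfl⟩
  | @sq_add a s _ ih =>
    obtain ⟨K, hK, y, hy, hys⟩ := ih
    obtain ⟨K', hK', ha⟩ := (Subfield.mem_sSup_of_directedOn hne hdir).1 a.2
    obtain ⟨L, hL, h1, h2⟩ := hdir K hK K' hK'
    refine ⟨L, hL, ⟨a, h2 ha⟩ * ⟨a, h2 ha⟩ + Subfield.inclusion h1 y,
      (isSumSq_map (Subfield.inclusion h1) hy).sq_add _, ?_⟩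
    have h3 : ((Subfield.inclusion h1 y : L) : Ω) = y := rfl
    simp [h3, hys]

/-- Zorn's lemma applies inside the algebraic closure, since a sum of squares involves finitely many
elements. A formally real `K[X]/(f)` embeds there over `K`, so maximality forces its root of `f`
into `K`. -/
theorem exists_maximalReal (F : Type u) [Field F] (hF : ¬ IsSumSq (-1 : F)) :
    ∃ (N : Type u) (_ : Field N) (_ : F →+* N), MaximalReal N := by
  let Ω := AlgebraicClosure F
  let A : Set (Subfield Ω) := {K | ¬ IsSumSq (-1 : K)}
  have h0 : (algebraMap F Ω).fieldRange ∈ A := by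
    intro h
    refine hF ?_
    have := isSumSq_map
      (RingEquiv.ofBijective (algebraMap F Ω).rangeRestrictField
        (algebraMap F Ω).rangeRestrictField_bijective).symm.toRingHom h
    simpa using this
  obtain ⟨K, hK0, hK⟩ := zorn_le_nonempty₀ A (fun c hc hchain y hy => by
    refine ⟨sSup c, fun h => ?_, fun z hz => le_sSup hz⟩
    obtain ⟨L, hL, y, hy, hy'⟩ := exists_isSumSq_of_sSup ⟨y, hy⟩ hchain.directedOn h
    refine hc hL ?_
    have : y = -1 := Subtype.ext (by simpa using hy')
    rwa [this] at hy) _ h0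
  refine ⟨K, inferInstance,
    (algebraMap F Ω).codRestrict K fun x => hK0 ⟨x, rfl⟩, hK.prop, fun f hf hreal => ?_⟩
  have := Fact.mk hf
  obtain ⟨z, hz⟩ := IsAlgClosed.exists_eval₂_eq_zero K.subtype f (by
    intro h
    exact hf.not_isUnit (isUnit_iff_degree_eq_zero.2 h))
  let φ : AdjoinRoot f →+* Ω := AdjoinRoot.lift K.subtype z hz
  have hle : K ≤ φ.fieldRange := by
    intro x hx
    exact ⟨AdjoinRoot.of f ⟨x, hx⟩, by simp [φ]⟩
  have hmem : φ.fieldRange ∈ A := by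
    intro h
    refine hreal ?_
    have := isSumSq_map
      (RingEquiv.ofBijective φ.rangeRestrictField
        φ.rangeRestrictField_bijective).symm.toRingHom h
    simpa using this
  have hzK : z ∈ K := hK.2 hmem hle ⟨AdjoinRoot.root f, by simp [φ]⟩
  refine ⟨⟨z, hzK⟩, ?_⟩
  have h1 : f.eval₂ K.subtype (K.subtype ⟨z, hzK⟩) = 0 := hz
  rwa [eval₂_at_apply, map_eq_zero] at h1

variable {N : Type*} [Field N]

/-- The expansion `(b + c√a)² = b² + a c² + 2bc√a` keeps the part free of `√a` in the form `p + a q`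
with `p`, `q` sums of squares. -/
theorem exists_of_isSumSq_adjoin_sqrt (a : N) {x : AdjoinRoot (Polynomial.X ^ 2 - Polynomial.C a)} (hx : IsSumSq x) :
    ∃ p q r : N, IsSumSq p ∧ IsSumSq q ∧
      x = AdjoinRoot.mk (Polynomial.X ^ 2 - Polynomial.C a) (Polynomial.C (p + a * q) + Polynomial.C r * Polynomial.X) := by
  have hdeg : (Polynomial.X ^ 2 - Polynomial.C a : N[X]).degree = 2 := degree_X_pow_sub_C (by norm_num) a
  have hsq : (AdjoinRoot.mk (Polynomial.X ^ 2 - Polynomial.C a)) (Polynomial.X ^ 2) = AdjoinRoot.mk (Polynomial.X ^ 2 - Polynomial.C a) (Polynomial.C a) := by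
    rw [AdjoinRoot.mk_eq_mk]
  induction hx with
  | zero => exact ⟨0, 0, 0, IsSumSq.zero, IsSumSq.zero, by simp⟩
  | sq_add y _ ih =>
    obtain ⟨p, q, r, hp, hq, rfl⟩ := ih
    obtain ⟨f, rfl⟩ := AdjoinRoot.mk_surjective y
    obtain ⟨b, c, hbc⟩ : ∃ b c : N, AdjoinRoot.mk (Polynomial.X ^ 2 - Polynomial.C a) f =
        AdjoinRoot.mk (Polynomial.X ^ 2 - Polynomial.C a) (Polynomial.C b + Polynomial.C c * Polynomial.X) := by
      have hm : (f % (Polynomial.X ^ 2 - Polynomial.C a)).degree ≤ 1 := by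
        have := EuclideanDomain.mod_lt f (b := Polynomial.X ^ 2 - Polynomial.C a) (by
          intro h; rw [h] at hdeg; simp at hdeg)
        have h2 : (f % (Polynomial.X ^ 2 - Polynomial.C a)).degree < 2 := by rw [← hdeg]; exact this
        exact Order.le_of_lt_succ h2
      refine ⟨(f % (Polynomial.X ^ 2 - Polynomial.C a)).coeff 0, (f % (Polynomial.X ^ 2 - Polynomial.C a)).coeff 1, ?_⟩
      rw [add_comm, ← eq_X_add_C_of_degree_le_one hm, AdjoinRoot.mk_eq_mk]
      exact ⟨f / (Polynomial.X ^ 2 - Polynomial.C a), by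
        rw [sub_eq_iff_eq_add]
        exact (EuclideanDomain.div_add_mod f _).symm⟩
    refine ⟨b * b + p, c * c + q, 2 * b * c + r, hp.sq_add _, hq.sq_add _, ?_⟩
    rw [hbc, ← map_mul, ← map_add]
    have h1 : (Polynomial.C b + Polynomial.C c * Polynomial.X) * (Polynomial.C b + Polynomial.C c * Polynomial.X) + (Polynomial.C (p + a * q) + Polynomial.C r * Polynomial.X) =
        Polynomial.C (b * b + p + a * q) + Polynomial.C (2 * b * c + r) * Polynomial.X + Polynomial.C (c * c) * Polynomial.X ^ 2 := by
      simp only [map_add, map_mul, map_ofNat]; ring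
    rw [h1, map_add, map_mul _ (Polynomial.C (c * c)), hsq, ← map_mul, ← map_add]
    congr 1
    simp only [map_add, map_mul, map_ofNat]; ring

namespace MaximalReal

/-- Adjoining `√a` destroys formal reality by maximality; the identity is the part free of `√a` in
the resulting expression of `-1`. -/
theorem exists_neg_one_eq (hN : MaximalReal N) {a : N} (ha : ¬ IsSquare a) :
    ∃ p q : N, IsSumSq p ∧ IsSumSq q ∧ -1 = p + a * q := by
  have hirr : Irreducible (Polynomial.X ^ 2 - Polynomial.C a : N[X]) :=
    X_pow_sub_C_irreducible_of_prime Nat.prime_two fun b hb => ha ⟨b, by rw [← hb, sq]⟩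
  have hs : IsSumSq (-1 : AdjoinRoot (Polynomial.X ^ 2 - Polynomial.C a)) := by
    by_contra h
    obtain ⟨z, hz⟩ := hN.exists_root _ hirr h
    refine ha ⟨z, ?_⟩
    simp only [Polynomial.eval_sub, Polynomial.eval_pow, Polynomial.eval_X, Polynomial.eval_C, sub_eq_zero] at hz
    rw [← hz, sq]
  obtain ⟨p, q, r, hp, hq, h⟩ := exists_of_isSumSq_adjoin_sqrt a hs
  refine ⟨p, q, hp, hq, ?_⟩
  have hdvd : (Polynomial.X ^ 2 - Polynomial.C a) ∣ (Polynomial.C (p + a * q + 1) + Polynomial.C r * Polynomial.X) := by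
    rw [← AdjoinRoot.mk_eq_zero]
    have : (Polynomial.C (p + a * q + 1) + Polynomial.C r * Polynomial.X) = (Polynomial.C (p + a * q) + Polynomial.C r * Polynomial.X) + 1 := by
      simp only [map_add, map_one]; ring
    rw [this, map_add, ← h, map_one, neg_add_cancel]
  have hzero := eq_zero_of_dvd_of_degree_lt hdvd (by
    rw [degree_X_pow_sub_C (by norm_num) a, add_comm]
    exact degree_linear_lt)
  have := congrArg (fun f => f.coeff 0) hzero
  simp only [Polynomial.coeff_add, coeff_C_zero, Polynomial.coeff_C_mul, coeff_X_zero, mul_zero, add_zero,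
    Polynomial.coeff_zero] at this
  exact (eq_neg_of_add_eq_zero_left this).symm

theorem isSquare_of_isSumSq (hN : MaximalReal N) {a : N} (ha : IsSumSq a) : IsSquare a := by
  by_contra h
  obtain ⟨p, q, hp, hq, hpq⟩ := hN.exists_neg_one_eq h
  exact hN.not_isSumSq (hpq ▸ hp.add (ha.mul hq))

theorem isSquare_or (hN : MaximalReal N) (a : N) : IsSquare a ∨ IsSquare (-a) := by
  by_contra! h
  obtain ⟨p, q, hp, hq, hpq⟩ := hN.exists_neg_one_eq h.1
  have hq0 : q ≠ 0 := by
    rintro rfl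
    rw [mul_zero, add_zero] at hpq
    exact hN.not_isSumSq (hpq ▸ hp)
  refine h.2 (hN.isSquare_of_isSumSq ?_)
  -- Solving `-1 = p + a q` for `-a` exhibits it as a sum of squares, hence as a square.
  have : -a = (1 * 1 + p) * q * (q⁻¹ * q⁻¹) := by
    have h1 : -a * q = 1 + p := by linear_combination hpq
    field_simp
    linear_combination h1
  rw [this]
  exact ((hp.sq_add 1).mul hq).mul (IsSumSq.mul_self _)

theorem eq_zero_of_isSquare_neg (hN : MaximalReal N) {a : N} (h1 : IsSquare a)
    (h2 : IsSquare (-a)) : a = 0 := by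
  by_contra h
  refine hN.not_isSumSq ?_
  have : (-1 : N) = a * (-a) * (a⁻¹ * a⁻¹) := by field_simp
  rw [this]
  exact (h1.isSumSq.mul h2.isSumSq).mul (IsSumSq.mul_self _)

/-- The nonnegative elements of a maximal formally real field. -/
def cone (hN : MaximalReal N) : RingCone N where
  carrier := {a | IsSquare a}
  mul_mem' := fun ha hb => ha.mul hb
  one_mem' := IsSquare.one
  add_mem' := fun ha hb => hN.isSquare_of_isSumSq (ha.isSumSq.add hb.isSumSq)
  zero_mem' := IsSquare.zero
  eq_zero_of_mem_of_neg_mem' := fun ha hb => hN.eq_zero_of_isSquare_neg ha hb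

theorem exists_linearOrder (hN : MaximalReal N) :
    ∃ _ : LinearOrder N, IsStrictOrderedRing N := by
  classical
  have : HasMemOrNegMem hN.cone := ⟨hN.isSquare_or⟩
  let : LinearOrder N := LinearOrder.mkOfAddGroupCone hN.cone
  have : IsOrderedRing N := IsOrderedRing.mkOfCone hN.cone
  exact ⟨inferInstance, IsOrderedRing.toIsStrictOrderedRing N⟩

end MaximalReal

/-- Each square is represented by its remainder modulo `f`. The degree bound drives the descent in
`MaximalReal.polyIVT`. -/
theorem exists_isSumSq_of_adjoinRoot {f : N[X]} (hf : f.natDegree ≠ 0) {x : AdjoinRoot f}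
    (hx : IsSumSq x) : ∃ s : N[X], IsSumSq s ∧ s.natDegree ≤ 2 * (f.natDegree - 1) ∧
      AdjoinRoot.mk f s = x := by
  induction hx with
  | zero => exact ⟨0, IsSumSq.zero, by simp, by simp⟩
  | sq_add y _ ih =>
    obtain ⟨s, hs, hd, rfl⟩ := ih
    obtain ⟨g, rfl⟩ := AdjoinRoot.mk_surjective y
    have hmod : (g % f).natDegree < f.natDegree := natDegree_mod_lt g hf
    refine ⟨(g % f) * (g % f) + s, hs.sq_add _, ?_, ?_⟩
    · refine (natDegree_add_le _ _).trans (max_le (natDegree_mul_le.trans ?_) hd)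
      omega
    · rw [map_add, map_mul]
      have : AdjoinRoot.mk f (g % f) = AdjoinRoot.mk f g := by
        rw [AdjoinRoot.mk_eq_mk]
        exact ⟨-(g / f), by
          have := EuclideanDomain.div_add_mod g f
          linear_combination this⟩
      rw [this]

theorem MaximalReal.polyIVT [LinearOrder N] [IsStrictOrderedRing N] (hN : MaximalReal N) :
    PolyIVT N := by
  intro f a b hab
  induction hn : f.natDegree using Nat.strong_induction_on generalizing f with | _ n ih
  intro hf
  have hf0 : f ≠ 0 := by rintro rfl; simp at hf
  have hnd : f.natDegree ≠ 0 := by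
    intro h
    rw [natDegree_eq_zero] at h
    obtain ⟨c, rfl⟩ := h
    simp only [Polynomial.eval_C] at hf
    exact absurd hf (not_lt.2 (mul_self_nonneg c))
  by_cases hirr : Irreducible f
  · by_cases hreal : IsSumSq (-1 : AdjoinRoot f)
    · obtain ⟨s, hs, hd, h1⟩ := exists_isSumSq_of_adjoinRoot hnd hreal
      -- Since `1 + s` is positive everywhere, the cofactor `g` has the sign of `f` and also changes
      -- sign. Its degree is at most `deg f - 2`, so induction yields a zero of `g`, where `1 + s`
      -- would vanish.
      obtain ⟨g, hg⟩ : f ∣ 1 + s := by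
        rw [← AdjoinRoot.mk_eq_zero, map_add, h1, map_one, add_neg_cancel]
      have hpos : ∀ x, 0 < f.eval x * g.eval x := by
        intro x
        rw [← Polynomial.eval_mul, ← hg, Polynomial.eval_add, eval_one]
        have : 0 ≤ s.eval x := (isSumSq_map (evalRingHom x) hs).nonneg
        linarith
      have hg0 : g ≠ 0 := by
        rintro rfl
        simpa using hpos 0
      have hgd : g.natDegree < n := by
        have h2 : (1 + s).natDegree ≤ 2 * (f.natDegree - 1) :=
          (natDegree_add_le _ _).trans (max_le (by simp) hd)
        rw [hg, natDegree_mul hf0 hg0] at h2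
        omega
      have hgs : g.eval a * g.eval b < 0 := by
        have h2 := mul_pos (hpos a) (hpos b)
        have h3 : 0 < (f.eval a * f.eval b) * (g.eval a * g.eval b) := by
          linarith [mul_mul_mul_comm (f.eval a) (g.eval a) (f.eval b) (g.eval b)]
        exact (neg_iff_neg_of_mul_pos h3).1 hf
      obtain ⟨c, -, -, hc⟩ := ih _ hgd g rfl hgs
      have := hpos c
      rw [hc, mul_zero] at this
      exact absurd this (lt_irrefl _)
    · obtain ⟨z, hz⟩ := hN.exists_root f hirr hreal
      obtain ⟨Q, hQ⟩ := dvd_iff_isRoot.2 (show f.IsRoot z from hz)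
      obtain ⟨u, hu, rfl⟩ := Polynomial.isUnit_iff.1
        ((hirr.isUnit_or_isUnit hQ).resolve_left (not_isUnit_X_sub_C z))
      rw [hQ] at hf
      simp only [Polynomial.eval_mul, Polynomial.eval_sub, Polynomial.eval_X, Polynomial.eval_C] at hf
      have hu2 : 0 < u * u := mul_self_pos.2 hu.ne_zero
      have h3 : (a - z) * (b - z) < 0 := by
        by_contra h
        have := mul_nonneg (not_lt.1 h) hu2.le
        linarith [mul_mul_mul_comm (a - z) u (b - z) u]
      refine ⟨z, ?_, ?_, hz⟩
      · by_contra h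
        have h := not_lt.1 h
        nlinarith [mul_nonneg (sub_nonneg.2 h) (sub_nonneg.2 (h.trans hab.le))]
      · by_contra h
        have h := not_lt.1 h
        nlinarith [mul_nonneg (sub_nonneg.2 h) (sub_nonneg.2 (hab.le.trans h))]
  · have hnu : ¬ IsUnit f := fun h => hnd (natDegree_eq_zero_of_isUnit h)
    rw [irreducible_iff] at hirr
    push Not at hirr
    obtain ⟨g, h, hgh, hgu, hhu⟩ := hirr hnu
    have hg0 : g ≠ 0 := by rintro rfl; simp [hgh] at hf0
    have hh0 : h ≠ 0 := by rintro rfl; simp [hgh] at hf0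
    have hdeg : ∀ k : N[X], k ≠ 0 → ¬ IsUnit k → k.natDegree ≠ 0 := by
      intro k hk hku h0
      rw [natDegree_eq_zero] at h0
      obtain ⟨c, rfl⟩ := h0
      exact hku (isUnit_C.2 (IsUnit.mk0 _ (by simpa using hk)))
    have hd1 := hdeg g hg0 hgu
    have hd2 := hdeg h hh0 hhu
    have hd : f.natDegree = g.natDegree + h.natDegree := by rw [hgh, natDegree_mul hg0 hh0]
    have hprod : (g.eval a * g.eval b) * (h.eval a * h.eval b) < 0 := by
      rw [hgh, Polynomial.eval_mul, Polynomial.eval_mul] at hf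
      linarith [mul_mul_mul_comm (g.eval a) (g.eval b) (h.eval a) (h.eval b),
        mul_mul_mul_comm (g.eval a) (h.eval a) (g.eval b) (h.eval b)]
    rcases mul_neg_iff.1 hprod with h1 | h1
    · obtain ⟨c, hc1, hc2, hc3⟩ := ih _ (by omega) h rfl h1.2
      exact ⟨c, hc1, hc2, by rw [hgh, Polynomial.eval_mul, hc3, mul_zero]⟩
    · obtain ⟨c, hc1, hc2, hc3⟩ := ih _ (by omega) g rfl h1.1
      exact ⟨c, hc1, hc2, by rw [hgh, Polynomial.eval_mul, hc3, zero_mul]⟩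

/-- A formally real field embeds into an ordered field with the intermediate value property. -/
theorem exists_polyIVT_extension (F : Type u) [Field F] (hF : ¬ IsSumSq (-1 : F)) :
    ∃ (N : Type u) (_ : Field N) (_ : LinearOrder N) (_ : IsStrictOrderedRing N) (_ : F →+* N),
      PolyIVT N := by
  obtain ⟨N, _, φ, hN⟩ := exists_maximalReal F hF
  obtain ⟨_, _⟩ := hN.exists_linearOrder
  exact ⟨N, inferInstance, inferInstance, inferInstance, φ, hN.polyIVT⟩

theorem strictMono_real {N : Type*} [Field N] [LinearOrder N] [IsStrictOrderedRing N]
    (i : ℝ →+* N) : StrictMono i := by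
  intro x y hxy
  have h1 : 0 < y - x := sub_pos.2 hxy
  rw [← sub_pos, ← map_sub, ← Real.mul_self_sqrt h1.le, map_mul]
  exact mul_self_pos.2 ((map_ne_zero i).2 (Real.sqrt_ne_zero'.2 h1))

/-- The real numbers are relatively algebraically closed in every ordered extension. -/
theorem mem_range_of_root_real {N : Type*} [Field N] [LinearOrder N] [IsStrictOrderedRing N]
    (i : ℝ →+* N) (z : N) (q : ℝ[X]) (hq : q ≠ 0) (hz : q.eval₂ i z = 0) : z ∈ Set.range i := by
  algebraize [i]
  have hzA : z ∈ algebraicClosure ℝ N :=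
    (mem_algebraicClosure_iff).2 ⟨q, hq, by rw [Polynomial.aeval_def]; exact hz⟩
  -- The algebraic closure of `ℝ` in `N` is `ℝ` or `ℂ`, and an ordered field has no square root of
  -- `-1`.
  rcases Real.nonempty_algEquiv_or (algebraicClosure ℝ N) with ⟨⟨e⟩⟩ | ⟨⟨e⟩⟩
  · refine ⟨e ⟨z, hzA⟩, ?_⟩
    have h1 : e.symm (e ⟨z, hzA⟩) = algebraMap ℝ _ (e ⟨z, hzA⟩) := by
      rw [← e.symm.commutes]; rfl
    rw [e.symm_apply_apply] at h1
    exact (congrArg Subtype.val h1).symm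
  · have h1 : e.symm Complex.I * e.symm Complex.I = -1 := by
      rw [← map_mul, Complex.I_mul_I, map_neg, map_one]
    have h2 : ((e.symm Complex.I : algebraicClosure ℝ N) : N) * (e.symm Complex.I : N) = -1 :=
      congrArg Subtype.val h1
    have h3 := mul_self_nonneg ((e.symm Complex.I : algebraicClosure ℝ N) : N)
    rw [h2] at h3
    exact absurd h3 (by simp)

end RealAlg

end

/-! ### Real prime ideals and the real Nullstellensatz. -/

namespace RealAlg

section

variable {A : Type*} [CommRing A]

/-- The multiplicative set of all `k ^ (2a) + σ` with `σ` a sum of squares. -/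
def powAddSumSq (k : A) : Submonoid A where
  carrier := {x | ∃ (a : ℕ) (σ : A), IsSumSq σ ∧ x = k ^ (2 * a) + σ}
  one_mem' := ⟨0, 0, IsSumSq.zero, by simp⟩
  mul_mem' := by
    rintro _ _ ⟨a, σ, hσ, rfl⟩ ⟨b, τ, hτ, rfl⟩
    have hpow : ∀ c, IsSumSq (k ^ (2 * c)) := fun c => by
      rw [two_mul, pow_add]; exact IsSumSq.mul_self _
    exact ⟨a + b, k ^ (2 * a) * τ + σ * k ^ (2 * b) + σ * τ,
      (((hpow a).mul hτ).add (hσ.mul (hpow b))).add (hσ.mul hτ), by ring⟩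

theorem add_mem_powAddSumSq {k x σ : A} (hx : x ∈ powAddSumSq k) (hσ : IsSumSq σ) :
    x + σ ∈ powAddSumSq k := by
  obtain ⟨a, τ, hτ, rfl⟩ := hx
  exact ⟨a, τ + σ, hτ.add hσ, by ring⟩

theorem exists_maximal_disjoint {I : Ideal A} {S : Submonoid A} (h : Disjoint (I : Set A) S) :
    ∃ P, I ≤ P ∧ Maximal (fun J : Ideal A => Disjoint (J : Set A) S) P := by
  refine zorn_le_nonempty₀ {J : Ideal A | Disjoint (J : Set A) S} (fun c hc hchain y hy => ?_) I h
  refine ⟨sSup c, Set.disjoint_left.2 fun x hx hxS => ?_, fun z hz => le_sSup hz⟩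
  obtain ⟨J, hJ, hxJ⟩ := (Submodule.mem_sSup_of_directed ⟨y, hy⟩ hchain.directedOn).1 hx
  exact Set.disjoint_left.1 (hc hJ) hxJ hxS

/-- If `d ∉ P`, then `P + (d)` meets the multiplicative set in some `π + c d`. Squaring and adding
`c² s` stays in that set, yet the result is congruent to `c² (d² + s)`, hence lies in `P`. -/
theorem mem_of_mul_self_add_mem {k : A} {P : Ideal A}
    (hP : Maximal (fun J : Ideal A => Disjoint (J : Set A) (powAddSumSq k)) P) {d s : A}
    (hs : IsSumSq s) (h : d * d + s ∈ P) : d ∈ P := by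
  by_contra hd
  have hnd : ¬ Disjoint ((P ⊔ Ideal.span {d} : Ideal A) : Set A) (powAddSumSq k) := by
    intro hdis
    exact hd (hP.2 hdis le_sup_left
      ((le_sup_right : Ideal.span {d} ≤ P ⊔ Ideal.span {d}) (Ideal.mem_span_singleton_self d)))
  obtain ⟨x, hx, hxS⟩ := Set.not_disjoint_iff.1 hnd
  obtain ⟨π, hπ, y, hy, rfl⟩ := Submodule.mem_sup.1 hx
  obtain ⟨c, rfl⟩ := Ideal.mem_span_singleton'.1 hy
  refine Set.disjoint_left.1 hP.prop ?_
    (add_mem_powAddSumSq (mul_mem hxS hxS) ((IsSumSq.mul_self c).mul hs))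
  have : (π + c * d) * (π + c * d) + c * c * s = (π + 2 * c * d) * π + c * c * (d * d + s) := by
    ring
  rw [this]
  exact add_mem (P.mul_mem_left _ hπ) (P.mul_mem_left _ h)

/-- Clearing denominators in `-1 = ∑ aᵢ²` produces `d² + s ∈ P` with `d ∉ P`. -/
theorem not_isSumSq_fractionRing {P : Ideal A} [P.IsPrime]
    (hP : ∀ d s : A, IsSumSq s → d * d + s ∈ P → d ∈ P) :
    ¬ IsSumSq (-1 : FractionRing (A ⧸ P)) := by
  let φ : A →+* FractionRing (A ⧸ P) := (algebraMap (A ⧸ P) _).comp (Ideal.Quotient.mk P)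
  have hφ : ∀ a, φ a = 0 ↔ a ∈ P := by
    intro a
    rw [← Ideal.Quotient.eq_zero_iff_mem, RingHom.comp_apply,
      map_eq_zero_iff _ (IsFractionRing.injective (A ⧸ P) (FractionRing (A ⧸ P)))]
  have key : ∀ x : FractionRing (A ⧸ P), IsSumSq x →
      ∃ d s : A, d ∉ P ∧ IsSumSq s ∧ φ d * φ d * x = φ s := by
    intro x hx
    induction hx with
    | zero => exact ⟨1, 0, fun h => Ideal.IsPrime.one_notMem ‹_› h, IsSumSq.zero, by simp⟩
    | sq_add a _ ih =>
      obtain ⟨d, s, hd, hs, hds⟩ := ih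
      obtain ⟨u, v, hv, rfl⟩ := IsFractionRing.div_surjective (A := A ⧸ P) a
      obtain ⟨u, rfl⟩ := Ideal.Quotient.mk_surjective u
      obtain ⟨v, rfl⟩ := Ideal.Quotient.mk_surjective v
      have hvP : v ∉ P := by
        rw [← Ideal.Quotient.eq_zero_iff_mem]
        exact nonZeroDivisors.ne_zero hv
      have hv0 : φ v ≠ 0 := fun h => hvP ((hφ v).1 h)
      refine ⟨v * d, (u * d) * (u * d) + v * v * s,
        fun h => (Ideal.IsPrime.mem_or_mem ‹_› h).elim hvP hd,
        ((IsSumSq.mul_self v).mul hs).sq_add _, ?_⟩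
      change φ (v * d) * φ (v * d) * (φ u / φ v * (φ u / φ v) + _) = _
      simp only [map_add, map_mul, ← hds]
      field_simp
  intro h
  obtain ⟨d, s, hd, hs, hds⟩ := key _ h
  refine hd (hP d s hs ((hφ _).1 ?_))
  rw [map_add, map_mul, ← hds]
  ring

end

/-- **Real Nullstellensatz**: a polynomial vanishing on the real zero set of a real radical ideal
belongs to the ideal. -/
theorem mem_of_isRealRadical {n s : ℕ} {p : Fin s → GMP.Poly n}
    (hI : GMP.IsRealRadical (GMP.idealOf p)) {k : GMP.Poly n}
    (hk : ∀ x ∈ GMP.realVariety p, eval x k = 0) : k ∈ GMP.idealOf p := by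
  classical
  by_contra hkI
  have hmem : ∀ f : GMP.Poly n, (∃ a : ℕ, 0 < a ∧ ∃ σ : GMP.Poly n, IsSumSq σ ∧
      f ^ (2 * a) + σ ∈ GMP.idealOf p) → f ∈ GMP.idealOf p := by
    intro f hf
    have : f ∈ (GMP.idealOf p : Set (GMP.Poly n)) := by
      rw [hI]; exact hf
    exact this
  have hdis : Disjoint (GMP.idealOf p : Set (GMP.Poly n)) (powAddSumSq k) := by
    refine Set.disjoint_left.2 ?_
    rintro _ hx ⟨a, σ, hσ, rfl⟩
    -- The real radical asks for a positive exponent while `a` may be `0` here, hence the extra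
    -- factor `k²`.
    refine hkI (hmem k ⟨a + 1, Nat.succ_pos _, k * k * σ, (IsSumSq.mul_self k).mul hσ, ?_⟩)
    have : k ^ (2 * (a + 1)) + k * k * σ = k * k * (k ^ (2 * a) + σ) := by ring
    rw [this]
    exact Ideal.mul_mem_left _ _ hx
  obtain ⟨P, hIP, hP⟩ := exists_maximal_disjoint hdis
  have : P.IsPrime := Ideal.isPrime_of_maximally_disjoint P (powAddSumSq k) hP.prop
    fun J hJ hJd => hJ.not_ge (hP.2 hJd hJ.le)
  have hkP : k ∉ P := fun h => Set.disjoint_left.1 hP.prop (P.mul_mem_left k h)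
    ⟨1, 0, IsSumSq.zero, by ring⟩
  obtain ⟨N, _, _, _, ψ, hN⟩ := exists_polyIVT_extension (FractionRing (GMP.Poly n ⧸ P))
    (not_isSumSq_fractionRing fun d s hs h => mem_of_mul_self_add_mem hP hs h)
  let φ : GMP.Poly n →+* N :=
    ψ.comp ((algebraMap (GMP.Poly n ⧸ P) _).comp (Ideal.Quotient.mk P))
  have hφ : ∀ a, φ a = 0 ↔ a ∈ P := by
    intro a
    rw [← Ideal.Quotient.eq_zero_iff_mem, RingHom.comp_apply, RingHom.comp_apply, map_eq_zero,
      map_eq_zero_iff _ (IsFractionRing.injective (GMP.Poly n ⧸ P) _)]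
  let i : ℝ →+* N := φ.comp C
  have hev : ∀ (z : N) (f : GMP.Poly n),
      (rename Fin.succ f).eval₂ i (Fin.cons z fun j => φ (X j)) = φ f := by
    intro z f
    rw [eval₂_rename]
    have : eval₂Hom i (fun j => φ (X j)) = φ := by
      apply MvPolynomial.ringHom_ext
      · intro c; simp [i]
      · intro j; simp
    conv_rhs => rw [← this]
    rfl
  -- Rabinowitsch trick: variable `0` stands for the inverse of `k`, so the real zero obtained is a
  -- point of the variety where `k` does not vanish.
  obtain ⟨w, hw⟩ := exists_zero_of_extension hN (n + 1) ℝ i (strictMono_real i)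
    (mem_range_of_root_real i) (Fin.cons (φ k)⁻¹ fun j => φ (X j))
    (insert (X 0 * rename Fin.succ k - 1) (Finset.univ.image fun l => rename Fin.succ (p l))) (by
      intro f hf
      rcases Finset.mem_insert.1 hf with rfl | hf
      · rw [eval₂_sub, eval₂_mul, hev, eval₂_X, eval₂_one, Fin.cons_zero,
          inv_mul_cancel₀ fun h => hkP ((hφ k).1 h), sub_self]
      · obtain ⟨l, -, rfl⟩ := Finset.mem_image.1 hf
        rw [hev, hφ]
        exact hIP (Ideal.subset_span ⟨l, rfl⟩))
  have h1 := hw _ (Finset.mem_insert_self _ _)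
  have h2 : eval (w ∘ Fin.succ) k = 0 := hk _ fun l => by
    have := hw _ (Finset.mem_insert_of_mem (Finset.mem_image_of_mem _ (Finset.mem_univ l)))
    rwa [eval_rename] at this
  rw [map_sub, map_mul, eval_rename, h2] at h1
  simp at h1

end RealAlg

section

open Filter Topology

/-! ### Attainment in conic programs and relative interiors. -/

namespace Conic

/-- A linear functional attains its maximum on the intersection of a closed convex cone with an
affine subspace, if no recession direction improves it and those that keep it are reversible. -/
theorem exists_max_of_recession {E : Type*} [NormedAddCommGroup E] [NormedSpace ℝ E]
    [FiniteDimensional ℝ E] {C : Set E} (hC : IsClosed C)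
    (hadd : ∀ x ∈ C, ∀ y ∈ C, x + y ∈ C) (hsmul : ∀ a : ℝ, 0 ≤ a → ∀ x ∈ C, a • x ∈ C)
    (K : Submodule ℝ E) (c : E →ₗ[ℝ] ℝ) {x₀ : E} (hx₀ : x₀ ∈ C)
    (h : ∀ x ∈ C, x ∈ K → c x ≤ 0 ∧ (c x = 0 → -x ∈ C)) :
    ∃ x ∈ C, x - x₀ ∈ K ∧ ∀ y ∈ C, y - x₀ ∈ K → c y ≤ c x := by
  have h0 : (0 : E) ∈ C := by simpa using hsmul 0 le_rfl x₀ hx₀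
  -- `L` is the lineality space of `C ∩ K`. The functional `c` vanishes on it, so restricting to a
  -- complement `L'` loses no value of `c`.
  let L : Submodule ℝ E :=
    { carrier := {x | x ∈ C ∧ -x ∈ C ∧ x ∈ K}
      add_mem' := fun {x y} hx hy => ⟨hadd _ hx.1 _ hy.1, by
        rw [neg_add]; exact hadd _ hx.2.1 _ hy.2.1, add_mem hx.2.2 hy.2.2⟩
      zero_mem' := ⟨h0, by simpa using h0, zero_mem K⟩
      smul_mem' := fun a x hx => by
        rcases le_total 0 a with ha | ha
        · exact ⟨hsmul a ha x hx.1, by rw [← smul_neg]; exact hsmul a ha _ hx.2.1,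
            K.smul_mem a hx.2.2⟩
        · have ha' : 0 ≤ -a := neg_nonneg.2 ha
          refine ⟨?_, ?_, K.smul_mem a hx.2.2⟩
          · have := hsmul (-a) ha' _ hx.2.1
            rwa [neg_smul_neg] at this
          · have := hsmul (-a) ha' _ hx.1
            rwa [neg_smul] at this }
  have hLc : ∀ x ∈ L, c x = 0 := fun x hx => by
    have h1 := (h x hx.1 hx.2.2).1
    have h2 := (h (-x) hx.2.1 (neg_mem hx.2.2)).1
    rw [map_neg] at h2
    linarith
  obtain ⟨L', hL'⟩ := L.exists_isCompl
  have hred : ∀ y ∈ C, y - x₀ ∈ K → ∃ m ∈ C, m - x₀ ∈ K ∧ m ∈ L' ∧ c m = c y := by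
    intro y hy hyK
    obtain ⟨l, hl, m, hm, hlm⟩ := Submodule.mem_sup.1
      ((hL'.sup_eq_top ▸ Submodule.mem_top : y ∈ L ⊔ L'))
    have hmy : m = y + -l := by rw [← hlm]; abel
    refine ⟨m, ?_, ?_, hm, ?_⟩
    · rw [hmy]; exact hadd _ hy _ hl.2.1
    · have : m - x₀ = (y - x₀) + -l := by rw [hmy]; abel
      rw [this]; exact add_mem hyK (neg_mem hl.2.2)
    · rw [hmy, map_add, map_neg, hLc l hl, neg_zero, add_zero]
  obtain ⟨m₀, hm₀C, hm₀K, hm₀L, -⟩ := hred x₀ hx₀ (by simp)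
  set S : Set E := {x | x ∈ C ∧ x - x₀ ∈ K ∧ x ∈ L' ∧ c m₀ ≤ c x} with hS
  have hcc : Continuous c := c.continuous_of_finiteDimensional
  have hKc : IsClosed (K : Set E) := K.closed_of_finiteDimensional
  have hL'c : IsClosed (L' : Set E) := L'.closed_of_finiteDimensional
  have hSc : IsClosed S := by
    refine hC.inter ((hKc.preimage (by fun_prop : Continuous fun x : E => x - x₀)).inter
      (hL'c.inter (isClosed_le continuous_const hcc)))
  -- An unbounded sequence, normalized, accumulates at a unit recession vector `u ∈ L'` with `0 ≤ c
  -- u`. The hypothesis then puts `u` in `L`, so `u = 0`, a contradiction.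
  have hSb : Bornology.IsBounded S := by
    by_contra hnb
    have hub : ∀ k : ℕ, ∃ x ∈ S, (k : ℝ) + 1 < ‖x‖ := by
      intro k
      by_contra hcon
      push Not at hcon
      exact hnb (isBounded_iff_forall_norm_le.2 ⟨_, hcon⟩)
    choose x hxS hxn using hub
    have hxpos : ∀ k, 0 < ‖x k‖ := fun k => lt_trans (by positivity) (hxn k)
    have htend : Tendsto (fun k => ‖x k‖⁻¹) atTop (𝓝 0) := by
      refine tendsto_inv_atTop_zero.comp (tendsto_atTop_mono (fun k => ?_)
        tendsto_natCast_atTop_atTop)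
      have := hxn k
      linarith
    obtain ⟨u, hu, φ, hφ, hlim⟩ := (isCompact_sphere (0 : E) 1).tendsto_subseq
      (x := fun k => ‖x k‖⁻¹ • x k) (fun k => by
        simp [norm_smul, inv_mul_cancel₀ (hxpos k).ne'])
    have htend' : Tendsto (fun k => ‖x (φ k)‖⁻¹) atTop (𝓝 0) := htend.comp hφ.tendsto_atTop
    have huC : u ∈ C := hC.mem_of_tendsto hlim (Eventually.of_forall fun k =>
      hsmul _ (inv_nonneg.2 (norm_nonneg _)) _ (hxS _).1)
    have huL : u ∈ L' := hL'c.mem_of_tendsto hlim (Eventually.of_forall fun k =>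
      L'.smul_mem _ (hxS _).2.2.1)
    have huK : u ∈ K := by
      have h1 : Tendsto (fun k => ‖x (φ k)‖⁻¹ • (x (φ k) - x₀)) atTop (𝓝 u) := by
        have := hlim.sub (htend'.smul_const x₀)
        simpa [smul_sub, Function.comp_def] using this
      exact hKc.mem_of_tendsto h1 (Eventually.of_forall fun k => K.smul_mem _ (hxS _).2.1)
    have huc : 0 ≤ c u := by
      have h1 : Tendsto (fun k => ‖x (φ k)‖⁻¹ * c m₀) atTop (𝓝 0) := by
        simpa using htend'.mul_const (c m₀)
      have h2 : Tendsto (fun k => c (‖x (φ k)‖⁻¹ • x (φ k))) atTop (𝓝 (c u)) :=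
        (hcc.tendsto u).comp hlim
      refine le_of_tendsto_of_tendsto' h1 h2 fun k => ?_
      rw [map_smul, smul_eq_mul]
      exact mul_le_mul_of_nonneg_left (hxS _).2.2.2 (inv_nonneg.2 (norm_nonneg _))
    obtain ⟨h1, h2⟩ := h u huC huK
    have huLL : u ∈ L := ⟨huC, h2 (le_antisymm h1 huc), huK⟩
    have hu0 : u = 0 := by
      have : u ∈ L ⊓ L' := ⟨huLL, huL⟩
      rwa [hL'.inf_eq_bot, Submodule.mem_bot] at this
    rw [hu0] at hu
    simp at hu
  obtain ⟨x, hxS, hmax⟩ := (Metric.isCompact_of_isClosed_isBounded hSc hSb).exists_isMaxOn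
    ⟨m₀, hm₀C, hm₀K, hm₀L, le_rfl⟩ hcc.continuousOn
  refine ⟨x, hxS.1, hxS.2.1, fun y hy hyK => ?_⟩
  obtain ⟨m, hmC, hmK, hmL, hmy⟩ := hred y hy hyK
  rw [← hmy]
  rcases le_total (c m₀) (c m) with hle | hle
  · exact hmax ⟨hmC, hmK, hmL, hle⟩
  · exact hle.trans hxS.2.2.2

/-- From a point of the intrinsic interior one can move away from any point of the set. -/
theorem exists_extend_of_mem_intrinsicInterior {E : Type*} [NormedAddCommGroup E] [NormedSpace ℝ E]
    {K : Set E} {b c : E} (hb : b ∈ intrinsicInterior ℝ K) (hc : c ∈ K) :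
    ∃ ε : ℝ, 0 < ε ∧ b + ε • (b - c) ∈ K := by
  obtain ⟨b', hb', rfl⟩ := mem_intrinsicInterior.1 hb
  let c' : affineSpan ℝ K := ⟨c, subset_affineSpan ℝ K hc⟩
  have hmem : ∀ ε : ℝ, (b' : E) + ε • ((b' : E) - c) ∈ affineSpan ℝ K := by
    intro ε
    have := AffineMap.lineMap_mem (Q := affineSpan ℝ K) (-ε) b'.2 c'.2
    rw [AffineMap.lineMap_apply] at this
    have h2 : (-ε) • (c - (b' : E)) = ε • ((b' : E) - c) := by
      rw [neg_smul, ← smul_neg, neg_sub]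
    rw [add_comm, ← h2]
    exact this
  let F : ℝ → affineSpan ℝ K := fun ε => ⟨_, hmem ε⟩
  have hF : Continuous F := by
    refine Continuous.subtype_mk ?_ _
    fun_prop
  have hF0 : F 0 = b' := Subtype.ext (by simp [F])
  have hnhds : F ⁻¹' ((↑) ⁻¹' K) ∈ 𝓝 (0 : ℝ) := by
    refine hF.continuousAt ?_
    rw [hF0]
    exact mem_interior_iff_mem_nhds.1 hb'
  obtain ⟨ε, hε, hball⟩ := Metric.mem_nhds_iff.1 hnhds
  refine ⟨ε / 2, half_pos hε, ?_⟩
  exact hball (by rw [Metric.mem_ball, dist_zero_right, Real.norm_of_nonneg (by linarith)]; linarith)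

end Conic

end

noncomputable section

/-! ### Degree control for sums of squares, Gröbner division and Gram matrices. -/

namespace GMP

section SumsOfSquares

variable {n : ℕ}

theorem sumSq_eq_sum {A : Type*} [CommSemiring A] {σ : A} (hσ : IsSumSq σ) :
    ∃ (k : ℕ) (q : Fin k → A), σ = ∑ i, q i ^ 2 := by
  induction hσ with
  | zero => exact ⟨0, Fin.elim0, by simp⟩
  | sq_add a _ ih =>
    obtain ⟨k, q, rfl⟩ := ih
    exact ⟨k + 1, Fin.cons a q, by simp [Fin.sum_univ_succ, sq]⟩

/-- No cancellation of leading terms in a sum of squares. -/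
theorem totalDegree_le_of_sum_sq {k d : ℕ} {q : Fin k → Poly n}
    (h : (∑ i, q i ^ 2).totalDegree ≤ 2 * d) (i : Fin k) : (q i).totalDegree ≤ d := by
  obtain ⟨i₀, -, hmax⟩ := Finset.univ.exists_max_image
    (fun i => MonomialOrder.degLex.toSyn (MonomialOrder.degLex.degree (q i))) ⟨i, Finset.mem_univ i⟩
  set α := MonomialOrder.degLex.degree (q i₀) with hα
  refine (degLex_totalDegree_monotone (hmax i (Finset.mem_univ i))).trans ?_
  by_cases h0 : q i₀ = 0
  · simp [h0]
  -- Since `α` is the largest leading exponent, only the `α`-coefficients contribute to the exponent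
  -- `2α`, and they enter squared.
  have hcoeff : coeff (α + α) (∑ i, q i ^ 2) = ∑ i, coeff α (q i) ^ 2 := by
    rw [coeff_sum]
    refine Finset.sum_congr rfl fun j _ => ?_
    rw [sq, MonomialOrder.coeff_mul_of_add_of_degree_le (hmax j (Finset.mem_univ j))
      (hmax j (Finset.mem_univ j)), sq]
  have hpos : 0 < coeff (α + α) (∑ i, q i ^ 2) := by
    rw [hcoeff]
    refine lt_of_lt_of_le ?_ (Finset.single_le_sum (f := fun i => coeff α (q i) ^ 2)
      (fun j _ => sq_nonneg _) (Finset.mem_univ i₀))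
    have hne : coeff α (q i₀) ≠ 0 := MonomialOrder.degLex.leadingCoeff_ne_zero_iff.2 h0
    positivity
  have h1 := le_totalDegree (mem_support_iff.2 hpos.ne')
  have h2 : (α + α).sum (fun _ e => e) = 2 * (q i₀).totalDegree := by
    have : (α + α).sum (fun _ e => e) = (α + α).degree := rfl
    rw [this, map_add, hα, degree_degLexDegree]; ring
  omega

end SumsOfSquares

/-- The ideal membership certificates given by division with respect to a Gröbner basis. -/
theorem mem_truncIdeal_of_groebner {n s : ℕ} {p : Fin s → Poly n} (hp : IsGrlexGroebner p) {t : ℕ}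
    {k : Poly n} (hk : k ∈ idealOf p) (hdeg : k.totalDegree ≤ 2 * t) : k ∈ truncIdeal p t := by
  classical
  -- Division requires invertible leading coefficients, so zero generators are dropped and later
  -- receive multiplier `0`.
  let T := {l : Fin s // p l ≠ 0}
  obtain ⟨a, r, hkr, ha, hr⟩ := MonomialOrder.degLex.div (b := fun l : T => p l)
    (fun l => (MonomialOrder.degLex.leadingCoeff_ne_zero_iff.2 l.2).isUnit) k
  have hsum : Finsupp.linearCombination (Poly n) (fun l : T => p l) a =
      ∑ l : Fin s, (if h : p l ≠ 0 then a ⟨l, h⟩ else 0) * p l := by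
    rw [Finsupp.linearCombination_apply, Finsupp.sum_fintype _ _ (by simp)]
    refine Finset.sum_of_injOn Subtype.val Subtype.val_injective.injOn (fun _ _ => by simp) ?_ ?_
    · intro l _ hl
      have : p l = 0 := by
        by_contra h
        exact hl ⟨⟨l, h⟩, by simp, rfl⟩
      simp [this]
    · intro l _
      simp [l.2]
  have hlin : Finsupp.linearCombination (Poly n) (fun l : T => p l) a ∈ idealOf p := by
    rw [hsum]
    exact Ideal.sum_mem _ fun l _ => Ideal.mul_mem_left _ _ (Ideal.subset_span ⟨l, rfl⟩)
  have hr0 : r = 0 := by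
    by_contra hr0
    have hrI : r ∈ idealOf p := by
      have : r = k - Finsupp.linearCombination (Poly n) (fun l : T => p l) a := by
        rw [hkr]; ring
      rw [this]
      exact sub_mem hk hlin
    obtain ⟨l, c, hc⟩ := hp r hrI hr0
    have hne : MonomialOrder.degLex.leadingTerm r ≠ 0 := fun h =>
      hr0 ((MonomialOrder.degLex.leadingTerm_eq_zero_iff r).1 h)
    have hpl : p l ≠ 0 := by
      intro h0
      rw [h0, MonomialOrder.degLex.leadingTerm_zero, zero_mul] at hc
      exact hne hc
    have hc0 : c ≠ 0 := by
      rintro rfl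
      rw [mul_zero] at hc
      exact hne hc
    refine hr (MonomialOrder.degLex.degree r) (MonomialOrder.degLex.degree_mem_support hr0)
      ⟨l, hpl⟩ ?_
    have := congrArg MonomialOrder.degLex.degree hc
    rw [MonomialOrder.degree_mul (fun h => hpl
      ((MonomialOrder.degLex.leadingTerm_eq_zero_iff _).1 h)) hc0,
      MonomialOrder.degree_leadingTerm, MonomialOrder.degree_leadingTerm] at this
    rw [this]
    exact le_self_add
  refine ⟨fun l => if h : p l ≠ 0 then a ⟨l, h⟩ else 0, fun l => ?_, ?_⟩
  · by_cases h : p l ≠ 0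
    · simp only [h, not_false_eq_true, dite_true, ne_eq]
      rw [mul_comm]
      -- The order is graded, so the division bound on leading exponents bounds the total degrees.
      exact (degLex_totalDegree_monotone (ha ⟨l, h⟩)).trans hdeg
    · simp [h]
  · rw [hkr, hr0, add_zero, hsum]

/-- A polynomial vanishing on a set with nonempty interior is zero. -/
theorem eq_zero_of_interior_nonempty {n : ℕ} {X : Set (Fin n → ℝ)} (hX : (interior X).Nonempty)
    {k : Poly n} (hk : ∀ x ∈ X, eval x k = 0) : k = 0 := by
  obtain ⟨x, hx⟩ := hX
  obtain ⟨ε, hε, hball⟩ := Metric.isOpen_iff.1 isOpen_interior x hx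
  refine funext_set (fun i => Set.Ioo (x i - ε) (x i + ε))
    (fun i => Set.Ioo_infinite (by linarith)) fun y hy => ?_
  rw [map_zero]
  refine hk y (interior_subset (hball ?_))
  rw [Metric.mem_ball, dist_pi_lt_iff hε]
  intro i
  have := hy i (Set.mem_univ i)
  rw [Real.dist_eq, abs_lt]
  constructor <;> linarith [this.1, this.2]

/-! ### Gram matrices -/

section Gram

variable {n r : ℕ}

/-- The linear combination `∑ vᵢ eᵢ`. -/
def comb (e : Fin r → Poly n) (v : Fin r → ℝ) : Poly n := ∑ i, C (v i) * e i

/-- The quadratic form `∑ Mᵢₖ eᵢ eₖ`. -/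
def gram (e : Fin r → Poly n) : (Fin r → Fin r → ℝ) →ₗ[ℝ] Poly n where
  toFun M := ∑ i, ∑ k, C (M i k) * (e i * e k)
  map_add' M M' := by simp [add_mul, Finset.sum_add_distrib]
  map_smul' a M := by simp [Finset.smul_sum, smul_eq_C_mul, mul_assoc]

theorem gram_apply (e : Fin r → Poly n) (M : Fin r → Fin r → ℝ) :
    gram e M = ∑ i, ∑ k, C (M i k) * (e i * e k) := rfl

theorem gram_sq (e : Fin r → Poly n) (v : Fin r → ℝ) :
    gram e (fun i k => v i * v k) = comb e v ^ 2 := by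
  rw [gram_apply, sq, comb, Finset.sum_mul_sum]
  refine Finset.sum_congr rfl fun i _ => Finset.sum_congr rfl fun k _ => ?_
  rw [C_mul]; ring

/-- The cone of symmetric positive semidefinite matrices. -/
def psd (r : ℕ) : Set (Fin r → Fin r → ℝ) :=
  {M | (∀ i k, M i k = M k i) ∧ ∀ v : Fin r → ℝ, 0 ≤ ∑ i, ∑ k, v i * (M i k * v k)}

theorem isClosed_psd (r : ℕ) : IsClosed (psd r) := by
  have h : psd r = (⋂ (i) (k), {M | M i k = M k i}) ∩
      ⋂ v : Fin r → ℝ, {M | 0 ≤ ∑ i, ∑ k, v i * (M i k * v k)} := by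
    ext M
    simp [psd]
  rw [h]
  exact (isClosed_iInter fun i => isClosed_iInter fun k =>
    isClosed_eq (by fun_prop) (by fun_prop)).inter
      (isClosed_iInter fun v => isClosed_le continuous_const (by fun_prop))

theorem zero_mem_psd : (0 : Fin r → Fin r → ℝ) ∈ psd r :=
  ⟨fun _ _ => rfl, fun v => by simp⟩

theorem add_mem_psd {M M' : Fin r → Fin r → ℝ} (h : M ∈ psd r) (h' : M' ∈ psd r) :
    M + M' ∈ psd r := by
  refine ⟨fun i k => by simp [h.1 i k, h'.1 i k], fun v => ?_⟩
  have := add_nonneg (h.2 v) (h'.2 v)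
  simpa [mul_add, add_mul, Finset.sum_add_distrib] using this

theorem smul_mem_psd {M : Fin r → Fin r → ℝ} {a : ℝ} (ha : 0 ≤ a) (h : M ∈ psd r) :
    a • M ∈ psd r := by
  refine ⟨fun i k => by simp [h.1 i k], fun v => ?_⟩
  have := mul_nonneg ha (h.2 v)
  simp only [Finset.mul_sum] at this
  refine this.trans_eq (Finset.sum_congr rfl fun i _ => Finset.sum_congr rfl fun k _ => ?_)
  simp only [Pi.smul_apply, smul_eq_mul]; ring

theorem rankOne_mem_psd (v : Fin r → ℝ) : (fun i k => v i * v k) ∈ psd r := by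
  refine ⟨fun i k => mul_comm _ _, fun w => ?_⟩
  have : ∑ i, ∑ k, w i * (v i * v k * w k) = (∑ i, w i * v i) * ∑ i, w i * v i := by
    rw [Finset.sum_mul_sum]
    refine Finset.sum_congr rfl fun i _ => Finset.sum_congr rfl fun k _ => by ring
  rw [this]
  exact mul_self_nonneg _

/-- Positive semidefinite matrices are sums of rank one matrices. -/
theorem exists_rankOne_of_mem_psd {M : Fin r → Fin r → ℝ} (hM : M ∈ psd r) :
    ∃ (k : ℕ) (v : Fin k → Fin r → ℝ), M = ∑ a, fun i k => v a i * v a k := by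
  have hpsd : (Matrix.of M).PosSemidef := by
    refine Matrix.posSemidef_iff_dotProduct_mulVec.2 ⟨?_, fun v => ?_⟩
    · ext i k
      simp [hM.1 k i]
    · have := hM.2 v
      simpa [dotProduct, Matrix.mulVec, Finset.mul_sum] using this
  obtain ⟨k, v, hv⟩ := Matrix.posSemidef_iff_eq_sum_vecMulVec.1 hpsd
  refine ⟨k, v, ?_⟩
  have : M = Matrix.of M := rfl
  rw [this, hv]
  ext i k
  simp [Matrix.sum_apply, Matrix.vecMulVec_apply]

theorem exists_sum_sq_of_mem_psd (e : Fin r → Poly n) {M : Fin r → Fin r → ℝ} (hM : M ∈ psd r) :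
    ∃ (k : ℕ) (v : Fin k → Fin r → ℝ), M = (∑ a, fun i k => v a i * v a k) ∧
      gram e M = ∑ a, comb e (v a) ^ 2 := by
  obtain ⟨k, v, hv⟩ := exists_rankOne_of_mem_psd hM
  refine ⟨k, v, hv, ?_⟩
  rw [hv, map_sum]
  simp only [gram_sq]

theorem totalDegree_comb_le {e : Fin r → Poly n} {d : ℕ} (he : ∀ i, (e i).totalDegree ≤ d)
    (v : Fin r → ℝ) : (comb e v).totalDegree ≤ d :=
  totalDegree_finsetSum_le fun i _ => (totalDegree_mul _ _).trans (by
    rw [totalDegree_C, zero_add]; exact he i)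

theorem gram_mem_sosDeg {e : Fin r → Poly n} {d : ℕ} (he : ∀ i, (e i).totalDegree ≤ d)
    {M : Fin r → Fin r → ℝ} (hM : M ∈ psd r) : gram e M ∈ sosDeg n (2 * d) := by
  obtain ⟨k, v, -, h⟩ := exists_sum_sq_of_mem_psd e hM
  rw [h]
  refine ⟨IsSumSq.sum_sq _ _, totalDegree_finsetSum_le fun a _ => (totalDegree_pow _ _).trans ?_⟩
  exact Nat.mul_le_mul_left 2 (totalDegree_comb_le he _)

theorem eval_gram_nonneg (e : Fin r → Poly n) {M : Fin r → Fin r → ℝ} (hM : M ∈ psd r)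
    (x : Fin n → ℝ) : 0 ≤ eval x (gram e M) := by
  obtain ⟨k, v, -, h⟩ := exists_sum_sq_of_mem_psd e hM
  rw [h, map_sum]
  exact Finset.sum_nonneg fun a _ => by rw [map_pow]; exact sq_nonneg _

/-- A basis of `P` modulo `N`. -/
theorem exists_basis_mod {V : Type*} [AddCommGroup V] [Module ℝ V] (P N : Submodule ℝ V)
    [FiniteDimensional ℝ P] :
    ∃ (r : ℕ) (e : Fin r → V), (∀ i, e i ∈ P) ∧ (∀ q ∈ P, ∃ v : Fin r → ℝ, q - ∑ i, v i • e i ∈ N) ∧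
      ∀ v : Fin r → ℝ, ∑ i, v i • e i ∈ N → v = 0 := by
  obtain ⟨W, hW⟩ := (N.comap P.subtype).exists_isCompl
  let B := Module.finBasis ℝ W
  have hsum : ∀ v : Fin _ → ℝ, ∑ i, v i • ((B i : P) : V) = (((∑ i, v i • B i : W) : P) : V) := by
    intro v
    simp
  refine ⟨_, fun i => ((B i : P) : V), fun i => (B i : P).2, fun q hq => ?_, fun v hv => ?_⟩
  · obtain ⟨a, ha, w, hw, haw⟩ := Submodule.mem_sup.1
      ((hW.sup_eq_top ▸ Submodule.mem_top : (⟨q, hq⟩ : P) ∈ N.comap P.subtype ⊔ W))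
    refine ⟨B.repr ⟨w, hw⟩, ?_⟩
    rw [hsum, B.sum_repr]
    have : q - (w : V) = a := by
      have := congrArg Subtype.val haw
      simp only [Submodule.coe_add] at this
      rw [← this, add_sub_cancel_right]
    rw [this]
    exact ha
  · rw [hsum] at hv
    have h1 : (∑ i, v i • B i : W) = 0 := by
      have : ((∑ i, v i • B i : W) : P) ∈ N.comap P.subtype ⊓ W := ⟨hv, (∑ i, v i • B i : W).2⟩
      rw [hW.inf_eq_bot, Submodule.mem_bot] at this
      exact Subtype.ext this
    exact funext (Fintype.linearIndependent_iff.1 B.linearIndependent v h1)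

/-- A basis of the polynomials of degree at most `d` modulo those whose product with `G` lies in
the ideal `I`. -/
theorem exists_reduced_basis (I : Ideal (Poly n)) (G : Poly n) (d : ℕ) :
    ∃ (r : ℕ) (e : Fin r → Poly n), (∀ i, (e i).totalDegree ≤ d) ∧
      (∀ q : Poly n, q.totalDegree ≤ d → ∃ v, (q - comb e v) * G ∈ I) ∧
      ∀ v, comb e v * G ∈ I → v = 0 := by
  obtain ⟨r, e, h1, h2, h3⟩ := exists_basis_mod (restrictTotalDegree (Fin n) ℝ d)
    ((I.restrictScalars ℝ).comap (LinearMap.mulRight ℝ G))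
  have hcomb : ∀ v, comb e v = ∑ i, v i • e i := fun v => by simp [comb, smul_eq_C_mul]
  refine ⟨r, e, fun i => (mem_restrictTotalDegree _ _ _).1 (h1 i), fun q hq => ?_, fun v hv => ?_⟩
  · obtain ⟨v, hv⟩ := h2 q ((mem_restrictTotalDegree _ _ _).2 hq)
    exact ⟨v, by rw [hcomb]; exact hv⟩
  · rw [hcomb] at hv
    exact h3 v hv

end Gram

end GMP

end

noncomputable section

namespace GMP

/-! ### Lower bounds modulo the truncated quadratic module. -/

section Feasibility

variable {n ℓ : ℕ}

theorem sosDeg_zero_mem (d : ℕ) : (0 : Poly n) ∈ sosDeg n d := ⟨IsSumSq.zero, by simp⟩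

theorem sosDeg_add_mem {d : ℕ} {σ τ : Poly n} (hσ : σ ∈ sosDeg n d) (hτ : τ ∈ sosDeg n d) :
    σ + τ ∈ sosDeg n d :=
  ⟨hσ.1.add hτ.1, (totalDegree_add _ _).trans (max_le hσ.2 hτ.2)⟩

theorem sosDeg_C_mul_mem {d : ℕ} {σ : Poly n} {a : ℝ} (ha : 0 ≤ a) (hσ : σ ∈ sosDeg n d) :
    C a * σ ∈ sosDeg n d := by
  refine ⟨IsSumSq.mul ?_ hσ.1, (totalDegree_mul _ _).trans (by simpa using hσ.2)⟩
  rw [← Real.mul_self_sqrt ha, C_mul]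
  exact IsSumSq.mul_self _

theorem mul_self_mem_sosDeg {d : ℕ} {q : Poly n} (hq : q.totalDegree ≤ d) :
    q * q ∈ sosDeg n (2 * d) :=
  ⟨IsSumSq.mul_self q, (totalDegree_mul _ _).trans (by omega)⟩

variable {g : Fin ℓ → Poly n} {t : ℕ}

theorem truncQM_add_mem {x y : Poly n} (hx : x ∈ truncQM g t) (hy : y ∈ truncQM g t) :
    x + y ∈ truncQM g t := by
  obtain ⟨σ₀, h₀, σ, h, rfl⟩ := hx
  obtain ⟨τ₀, h₀', τ, h', rfl⟩ := hy
  refine ⟨_, sosDeg_add_mem h₀ h₀', fun j => σ j + τ j, fun j => sosDeg_add_mem (h j) (h' j), ?_⟩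
  simp only [add_mul, Finset.sum_add_distrib]
  ring

theorem truncQM_C_mul_mem {x : Poly n} {a : ℝ} (ha : 0 ≤ a) (hx : x ∈ truncQM g t) :
    C a * x ∈ truncQM g t := by
  obtain ⟨σ₀, h₀, σ, h, rfl⟩ := hx
  refine ⟨_, sosDeg_C_mul_mem ha h₀, fun j => C a * σ j, fun j => sosDeg_C_mul_mem ha (h j), ?_⟩
  simp only [mul_add, Finset.mul_sum, mul_assoc]

theorem truncQM_zero_mem : (0 : Poly n) ∈ truncQM g t :=
  ⟨0, sosDeg_zero_mem _, 0, fun _ => sosDeg_zero_mem _, by simp⟩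

theorem mul_self_mem_truncQM {q : Poly n} (hq : q.totalDegree ≤ t) : q * q ∈ truncQM g t :=
  ⟨q * q, mul_self_mem_sosDeg hq, 0, fun _ => sosDeg_zero_mem _, by simp⟩

theorem mul_self_mul_mem_truncQM {q : Poly n} (j : Fin ℓ)
    (hq : q.totalDegree ≤ t - halfDeg (g j)) : q * q * g j ∈ truncQM g t := by
  classical
  refine ⟨0, sosDeg_zero_mem _, Pi.single j (q * q), fun i => ?_, ?_⟩
  · by_cases hi : i = j
    · subst hi
      simpa using mul_self_mem_sosDeg hq
    · simpa [hi] using sosDeg_zero_mem _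
  · rw [zero_add, Finset.sum_eq_single j]
    · simp
    · intro i _ hi
      simp [hi]
    · simp

/-- The polynomials that are bounded below modulo the truncated quadratic module. -/
def boundedBelow (g : Fin ℓ → Poly n) (t : ℕ) : Set (Poly n) :=
  {f | ∃ N : ℝ, C N + f ∈ truncQM g t}

theorem boundedBelow_add_mem {x y : Poly n} (hx : x ∈ boundedBelow g t)
    (hy : y ∈ boundedBelow g t) : x + y ∈ boundedBelow g t := by
  obtain ⟨N, hN⟩ := hx
  obtain ⟨N', hN'⟩ := hy
  refine ⟨N + N', ?_⟩
  have := truncQM_add_mem hN hN'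
  rwa [add_add_add_comm, ← C_add] at this

theorem boundedBelow_C_mul_mem {x : Poly n} {a : ℝ} (ha : 0 ≤ a) (hx : x ∈ boundedBelow g t) :
    C a * x ∈ boundedBelow g t := by
  obtain ⟨N, hN⟩ := hx
  refine ⟨a * N, ?_⟩
  have := truncQM_C_mul_mem ha hN
  rwa [mul_add, ← C_mul] at this

theorem truncQM_subset_boundedBelow : truncQM g t ⊆ boundedBelow g t :=
  fun x hx => ⟨0, by simpa using hx⟩

theorem boundedBelow_sum_mem {ι : Type*} {s : Finset ι} {x : ι → Poly n}
    (hx : ∀ i ∈ s, x i ∈ boundedBelow g t) : ∑ i ∈ s, x i ∈ boundedBelow g t := by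
  classical
  induction s using Finset.induction_on with
  | empty => exact truncQM_subset_boundedBelow truncQM_zero_mem
  | insert i s hi ih =>
    rw [Finset.sum_insert hi]
    exact boundedBelow_add_mem (hx i (Finset.mem_insert_self i s))
      (ih fun k hk => hx k (Finset.mem_insert_of_mem hk))

theorem halfDeg_ballPoly_le (R : ℝ) : halfDeg (ballPoly n R) ≤ 1 := by
  have : (ballPoly n R).totalDegree ≤ 2 := by
    refine (totalDegree_sub _ _).trans (max_le (by simp) ?_)
    refine totalDegree_finsetSum_le fun i _ => ?_
    rw [totalDegree_X_pow]
  unfold halfDeg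
  omega

theorem totalDegree_monomial_one_le (β : Fin n →₀ ℕ) :
    (monomial β (1 : ℝ)).totalDegree ≤ β.degree := by
  rw [totalDegree_monomial _ one_ne_zero]
  exact le_rfl

/-- Induction on the degree through `-(q xᵢ)² = q² (R - ‖x‖²) + ∑_{a ≠ i} (q xₐ)² + R (-q²)`. -/
theorem neg_monomial_sq_mem_boundedBelow {R : ℝ} (hR : 0 < R) {j : Fin ℓ}
    (hj : g j = ballPoly n R) (k : ℕ) :
    ∀ β : Fin n →₀ ℕ, β.degree = k → k ≤ t →
      -(monomial β (1 : ℝ) * monomial β 1) ∈ boundedBelow g t := by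
  classical
  induction k with
  | zero =>
    intro β hβ _
    rw [Finsupp.degree_eq_zero_iff] at hβ
    subst hβ
    refine ⟨1, ?_⟩
    have : C (1 : ℝ) + -(monomial (0 : Fin n →₀ ℕ) (1 : ℝ) * monomial 0 1) = 0 := by
      simp [monomial_zero']
    rw [this]
    exact truncQM_zero_mem
  | succ k ih =>
    intro β hβ hkt
    obtain ⟨i, hi⟩ : ∃ i, β i ≠ 0 := by
      by_contra! h
      have : β = 0 := Finsupp.ext h
      simp [this] at hβ
    obtain ⟨γ, rfl⟩ : ∃ γ, β = γ + Finsupp.single i 1 :=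
      ⟨β - Finsupp.single i 1, (tsub_add_cancel_of_le
        (Finsupp.single_le_iff.2 (Nat.one_le_iff_ne_zero.2 hi))).symm⟩
    have hγ : γ.degree = k := by
      rw [map_add, Finsupp.degree_single] at hβ
      omega
    set q : Poly n := monomial γ 1 with hq
    have hqd : q.totalDegree ≤ k := (totalDegree_monomial_one_le γ).trans_eq hγ
    have hmon : monomial (γ + Finsupp.single i 1) (1 : ℝ) = q * X i := by
      rw [hq, X, monomial_mul, one_mul]
    rw [hmon]
    have hball := halfDeg_ballPoly_le (n := n) R
    have h1 : q * q * g j ∈ boundedBelow g t := truncQM_subset_boundedBelow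
      (mul_self_mul_mem_truncQM j (by rw [hj]; omega))
    have h2 : ∑ a ∈ Finset.univ.erase i, (q * X a) * (q * X a) ∈ boundedBelow g t :=
      boundedBelow_sum_mem fun a _ => truncQM_subset_boundedBelow (mul_self_mem_truncQM
        ((totalDegree_mul _ _).trans (by rw [totalDegree_X]; omega)))
    have h3 := boundedBelow_C_mul_mem hR.le (ih γ hγ (by omega))
    have key : -(q * X i * (q * X i)) = q * q * g j +
        ∑ a ∈ Finset.univ.erase i, (q * X a) * (q * X a) + C R * -(q * q) := by
      rw [hj, ballPoly, ← Finset.add_sum_erase _ _ (Finset.mem_univ i)]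
      have : ∑ a ∈ Finset.univ.erase i, (q * X a) * (q * X a) =
          q * q * ∑ a ∈ Finset.univ.erase i, X a ^ 2 := by
        rw [Finset.mul_sum]
        exact Finset.sum_congr rfl fun a _ => by ring
      rw [this]
      ring
    rw [key]
    exact boundedBelow_add_mem (boundedBelow_add_mem h1 h2) h3

/-- The ball constraint makes every polynomial bounded below. -/
theorem mem_boundedBelow {R : ℝ} (hR : 0 < R) {j : Fin ℓ} (hj : g j = ballPoly n R) {f : Poly n}
    (hf : f.totalDegree ≤ 2 * t) : f ∈ boundedBelow g t := by
  rw [f.as_sum]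
  refine boundedBelow_sum_mem fun α hα => ?_
  have hαd : α.degree ≤ 2 * t := (le_totalDegree hα).trans hf
  -- A monomial of degree at most `2t` splits into factors `u`, `v` of degree at most `t`, and `c u
  -- v = ½ (u + c v)² - ½ u² - ½ c² v²`.
  obtain ⟨β, hβα, hβ⟩ := Finsupp.exists_le_degree_eq α (min t α.degree) (min_le_right _ _)
  obtain ⟨γ, rfl⟩ := exists_add_of_le hβα
  rw [map_add] at hβ hαd
  have hβt : β.degree ≤ t := by omega
  have hγt : γ.degree ≤ t := by omega
  set c := coeff (β + γ) f
  have h1 := boundedBelow_C_mul_mem (a := 1 / 2) (by norm_num)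
    (truncQM_subset_boundedBelow (mul_self_mem_truncQM (g := g) (t := t)
      (q := monomial β 1 + C c * monomial γ 1) (by
        refine (totalDegree_add _ _).trans (max_le ((totalDegree_monomial_one_le β).trans hβt) ?_)
        refine (totalDegree_mul _ _).trans ?_
        rw [totalDegree_C, zero_add]
        exact (totalDegree_monomial_one_le γ).trans hγt)))
  have h2 := boundedBelow_C_mul_mem (a := 1 / 2) (by norm_num)
    (neg_monomial_sq_mem_boundedBelow hR hj _ β rfl hβt)
  have h3 := boundedBelow_C_mul_mem (a := 1 / 2 * (c * c))
    (mul_nonneg (by norm_num) (mul_self_nonneg c))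
    (neg_monomial_sq_mem_boundedBelow hR hj _ γ rfl hγt)
  have hmon : monomial (β + γ) c = C c * (monomial β 1 * monomial γ 1) := by
    rw [monomial_mul, C_mul_monomial, one_mul, mul_one]
  have hhalf : (C (1 / 2 : ℝ) : Poly n) * 2 = 1 := by
    rw [show (2 : Poly n) = C 2 from (map_ofNat C 2).symm, ← C_mul]
    norm_num
  have key : monomial (β + γ) c =
      C (1 / 2) * ((monomial β 1 + C c * monomial γ 1) * (monomial β 1 + C c * monomial γ 1)) +
        C (1 / 2) * -(monomial β 1 * monomial β 1) +
          C (1 / 2 * (c * c)) * -(monomial γ 1 * monomial γ 1) := by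
    rw [hmon, C_mul, C_mul]
    linear_combination (-(C c * (monomial β 1 * monomial γ 1))) * hhalf
  rw [key]
  exact boundedBelow_add_mem (boundedBelow_add_mem h1 h2) h3

end Feasibility

/-! ### The moment cone and functionals nonpositive on `X`. -/

section Moments

variable {n m s ℓ : ℕ} {p : Fin s → Poly n} {g : Fin ℓ → Poly n} {h : Fin m → Poly n}

theorem semialgSet_subset_closedBall {R : ℝ} {j : Fin ℓ} (hj : g j = ballPoly n R) :
    semialgSet p g ⊆ Metric.closedBall 0 (Real.sqrt R) := by
  intro x hx
  have h1 := hx.2 j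
  rw [hj, ballPoly] at h1
  simp only [map_sub, eval_C, map_sum, map_pow, eval_X] at h1
  rw [mem_closedBall_zero_iff, pi_norm_le_iff_of_nonneg (Real.sqrt_nonneg _)]
  intro i
  rw [Real.norm_eq_abs]
  refine Real.abs_le_sqrt ?_
  have := Finset.single_le_sum (f := fun i => x i ^ 2) (fun a _ => sq_nonneg (x a))
    (Finset.mem_univ i)
  linarith

theorem sum_mul_nonpos_of_mem_momentCone {X : Set (Fin n → ℝ)} (hX : Bornology.IsBounded X)
    {c : Fin m → ℝ} (hc : c ∈ momentCone X h) {lam : Fin m → ℝ}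
    (hlam : ∀ x ∈ X, ∑ i, lam i * eval x (h i) ≤ 0) : ∑ i, c i * lam i ≤ 0 := by
  obtain ⟨μ, _, hμ, hc⟩ := hc
  have hae : ∀ᵐ x ∂μ, x ∈ X := by
    rw [ae_iff]
    exact hμ
  obtain ⟨r, hr⟩ := hX.subset_closedBall 0
  have hint : ∀ i, Integrable (fun x => eval x (h i)) μ := by
    intro i
    have hcont : Continuous fun x : Fin n → ℝ => eval x (h i) := (h i).continuous_eval
    obtain ⟨B, hB⟩ := (isCompact_closedBall (0 : Fin n → ℝ) r).exists_bound_of_continuousOn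
      hcont.continuousOn
    refine Integrable.of_bound hcont.aestronglyMeasurable B ?_
    filter_upwards [hae] with x hx using hB x (hr hx)
  have : ∑ i, c i * lam i = ∫ x, ∑ i, lam i * eval x (h i) ∂μ := by
    rw [integral_finsetSum _ fun i _ => (hint i).const_mul _]
    refine Finset.sum_congr rfl fun i _ => ?_
    rw [integral_const_mul, hc i, mul_comm]
  rw [this]
  refine integral_nonpos_of_ae ?_
  filter_upwards [hae] with x hx using hlam x hx

theorem eval_mem_momentCone {X : Set (Fin n → ℝ)} {x : Fin n → ℝ} (hx : x ∈ X) :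
    (fun i => eval x (h i)) ∈ momentCone X h := by
  refine ⟨Measure.dirac x, inferInstance, ?_, fun i => ?_⟩
  · rw [Measure.dirac_apply]
    simp [hx]
  · rw [integral_dirac]

/-- A functional that is nonpositive on `X` and vanishes at a relative interior point of the moment
cone vanishes on `X`. -/
theorem sum_eq_zero_of_mem_intrinsicInterior {X : Set (Fin n → ℝ)} (hX : Bornology.IsBounded X)
    {b : Fin m → ℝ} (hb : b ∈ intrinsicInterior ℝ (momentCone X h)) {lam : Fin m → ℝ}
    (hlam : ∀ x ∈ X, ∑ i, lam i * eval x (h i) ≤ 0) (h0 : ∑ i, b i * lam i = 0)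
    {x : Fin n → ℝ} (hx : x ∈ X) : ∑ i, lam i * eval x (h i) = 0 := by
  -- The moment vector of the Dirac mass at `x` is pushed through `b`. Pairing `(1 + ε) b - ε δₓ`
  -- with `lam` leaves `-ε` times the value at `x`, which must be nonpositive.
  obtain ⟨ε, hε, hmem⟩ :=
    Conic.exists_extend_of_mem_intrinsicInterior hb (eval_mem_momentCone (h := h) hx)
  have h1 := sum_mul_nonpos_of_mem_momentCone hX hmem hlam
  have h2 : ∑ i, (b + ε • (b - fun i => eval x (h i))) i * lam i =
      (1 + ε) * ∑ i, b i * lam i - ε * ∑ i, lam i * eval x (h i) := by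
    rw [Finset.mul_sum, Finset.mul_sum, ← Finset.sum_sub_distrib]
    refine Finset.sum_congr rfl fun i _ => ?_
    simp only [Pi.add_apply, Pi.smul_apply, Pi.sub_apply, smul_eq_mul]
    ring
  rw [h2, h0, mul_zero, zero_sub] at h1
  have h3 := hlam x hx
  nlinarith

end Moments

end GMP

end

noncomputable section

namespace GMP

/-! ### The Gram matrix program modulo the ideal. -/

section Attainment

variable {n m s ℓ : ℕ} {p : Fin s → Poly n} {g : Fin ℓ → Poly n} {h : Fin m → Poly n}
  {f : Poly n} {t : ℕ}

/-- The constraint polynomials together with the constant `1`. -/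
def weight (g : Fin ℓ → Poly n) : Option (Fin ℓ) → Poly n := fun j => j.elim 1 g

/-- The half degrees available to the multipliers of `weight g`. -/
def multDeg (g : Fin ℓ → Poly n) (t : ℕ) : Option (Fin ℓ) → ℕ :=
  fun j => j.elim t fun j => t - halfDeg (g j)

theorem totalDegree_le_of_halfDeg_le {k : Poly n} (hk : halfDeg k ≤ t) :
    k.totalDegree ≤ 2 * t := by
  unfold halfDeg at hk
  omega

theorem totalDegree_mul_weight_le (hg : ∀ j, halfDeg (g j) ≤ t) (j : Option (Fin ℓ)) {σ : Poly n}
    (hσ : σ.totalDegree ≤ 2 * multDeg g t j) : (σ * weight g j).totalDegree ≤ 2 * t := by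
  refine (totalDegree_mul _ _).trans ?_
  cases j with
  | none => simpa [weight, multDeg] using hσ
  | some j =>
    have h1 := hg j
    simp only [weight, multDeg, Option.elim_some] at hσ ⊢
    unfold halfDeg at h1 hσ
    omega

theorem mem_truncQM_iff {q : Poly n} :
    q ∈ truncQM g t ↔ ∃ σ : Option (Fin ℓ) → Poly n,
      (∀ j, σ j ∈ sosDeg n (2 * multDeg g t j)) ∧ q = ∑ j, σ j * weight g j := by
  constructor
  · rintro ⟨σ₀, h₀, σ, hσ, rfl⟩
    refine ⟨fun j => j.elim σ₀ σ, fun j => ?_, ?_⟩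
    · cases j with
      | none => exact h₀
      | some j => exact hσ j
    · simp [Fintype.sum_option, weight]
  · rintro ⟨σ, hσ, rfl⟩
    exact ⟨σ none, hσ none, fun j => σ (some j), fun j => hσ (some j), by
      simp [Fintype.sum_option, weight]⟩

theorem truncIdeal_subset : truncIdeal p t ⊆ idealOf p := by
  rintro _ ⟨k, -, rfl⟩
  exact Ideal.sum_mem _ fun l _ => Ideal.mul_mem_left _ _ (Ideal.subset_span ⟨l, rfl⟩)

theorem eval_eq_zero_of_mem_idealOf {k : Poly n} (hk : k ∈ idealOf p) {x : Fin n → ℝ}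
    (hx : x ∈ realVariety p) : eval x k = 0 := by
  have : idealOf p ≤ RingHom.ker (eval x) := by
    rw [idealOf, Ideal.span_le]
    rintro _ ⟨l, rfl⟩
    exact hx l
  exact this hk

/-- Replacing each `q` by its representative `q'` in the reduced basis changes `q² G` by `(q + q')(q
- q') G ∈ I`. -/
theorem exists_gram_of_mem_sosDeg {I : Ideal (Poly n)} {G : Poly n} {d r : ℕ} {e : Fin r → Poly n}
    (he : ∀ q : Poly n, q.totalDegree ≤ d → ∃ v, (q - comb e v) * G ∈ I) {σ : Poly n}
    (hσ : σ ∈ sosDeg n (2 * d)) : ∃ M ∈ psd r, σ * G - gram e M * G ∈ I := by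
  obtain ⟨hs, hd⟩ := hσ
  obtain ⟨k, q, rfl⟩ := sumSq_eq_sum hs
  choose v hv using fun a => he (q a) (totalDegree_le_of_sum_sq hd a)
  refine ⟨∑ a, fun i k => v a i * v a k, ?_, ?_⟩
  · exact Finset.sum_induction _ (· ∈ psd r) (fun _ _ => add_mem_psd) zero_mem_psd
      fun a _ => rankOne_mem_psd (v a)
  · rw [map_sum, Finset.sum_mul, Finset.sum_mul, ← Finset.sum_sub_distrib]
    refine Ideal.sum_mem _ fun a _ => ?_
    rw [gram_sq]
    have : q a ^ 2 * G - comb e (v a) ^ 2 * G =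
        (q a + comb e (v a)) * ((q a - comb e (v a)) * G) := by ring
    rw [this]
    exact I.mul_mem_left _ (hv a)

/-- The space of multipliers `λ` and families of Gram matrices. -/
abbrev GramSpace (m : ℕ) {ι : Type*} (r : ι → ℕ) : Type _ :=
  (Fin m → ℝ) × ((j : ι) → Fin (r j) → Fin (r j) → ℝ)

/-- The linear map `(λ, M) ↦ ∑ᵢ λᵢ hᵢ + ∑ⱼ (eⱼᵀ Mⱼ eⱼ) wⱼ`. -/
def certificate {ι : Type*} [Fintype ι] {r : ι → ℕ} (h : Fin m → Poly n) (w : ι → Poly n)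
    (e : (j : ι) → Fin (r j) → Poly n) : GramSpace m r →ₗ[ℝ] Poly n where
  toFun x := ∑ i, C (x.1 i) * h i + ∑ j, gram (e j) (x.2 j) * w j
  map_add' x y := by
    simp only [Prod.fst_add, Prod.snd_add, Pi.add_apply, map_add, add_mul,
      Finset.sum_add_distrib]
    ring
  map_smul' a x := by
    simp only [Prod.smul_fst, Prod.smul_snd, Pi.smul_apply, smul_eq_mul, C_mul, map_smul,
      smul_eq_C_mul, mul_add, Finset.mul_sum, mul_assoc, RingHom.id_apply]

/-- The linear functional `(λ, M) ↦ ∑ᵢ bᵢ λᵢ`. -/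
def objective {ι : Type*} (b : Fin m → ℝ) (r : ι → ℕ) : GramSpace m r →ₗ[ℝ] ℝ where
  toFun x := ∑ i, b i * x.1 i
  map_add' x y := by simp [mul_add, Finset.sum_add_distrib]
  map_smul' a x := by
    simp only [Prod.smul_fst, Pi.smul_apply, smul_eq_mul, Finset.mul_sum, RingHom.id_apply]
    exact Finset.sum_congr rfl fun i _ => by ring

/-- Attainment from the two properties of the ideal `I = (p₁, …, pₛ)` that both cases provide:
`I` is the vanishing ideal of `X`, and its truncation is generated in bounded degree. -/
theorem exists_isMaxOn {R : ℝ} (hR : 0 < R) {j₀ : Fin ℓ} (hball : g j₀ = ballPoly n R) {i₀ : Fin m}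
    (hh : h i₀ = 1)
    (hvanish : ∀ k : Poly n, (∀ x ∈ semialgSet p g, eval x k = 0) → k ∈ idealOf p)
    (htrunc : ∀ k ∈ idealOf p, k.totalDegree ≤ 2 * t → k ∈ truncIdeal p t) {b : Fin m → ℝ}
    (hb : b ∈ intrinsicInterior ℝ (momentCone (semialgSet p g) h))
    (hgt : ∀ j, halfDeg (g j) ≤ t) (hht : ∀ i, halfDeg (h i) ≤ t) (hft : halfDeg f ≤ t) :
    ∃ lam ∈ strFeasible p g h f t,
      IsMaxOn (fun l : Fin m → ℝ => ∑ i, b i * l i) (strFeasible p g h f t) lam := by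
  classical
  have hbdd : Bornology.IsBounded (semialgSet p g) :=
    Metric.isBounded_closedBall.subset (semialgSet_subset_closedBall hball)
  choose r e he₁ he₂ he₃ using fun j =>
    exists_reduced_basis (idealOf p) (weight g j) (multDeg g t j)
  let Φ := certificate h (weight g) e
  have hΦ : ∀ x, Φ x = ∑ i, C (x.1 i) * h i + ∑ j, gram (e j) (x.2 j) * weight g j :=
    fun _ => rfl
  let K : Submodule ℝ (GramSpace m r) := ((idealOf p).restrictScalars ℝ).comap Φ
  have hK : ∀ x, x ∈ K ↔ Φ x ∈ idealOf p := fun _ => Iff.rfl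
  let c := objective b r
  let Cone : Set (GramSpace m r) := {x | ∀ j, x.2 j ∈ psd (r j)}
  have hclosed : IsClosed Cone := by
    have : Cone = ⋂ j, (fun x : GramSpace m r => x.2 j) ⁻¹' psd (r j) := by
      ext x; simp [Cone]
    rw [this]
    exact isClosed_iInter fun j => (isClosed_psd _).preimage (by fun_prop)
  have hlift : ∀ lam ∈ strFeasible p g h f t, ∃ x ∈ Cone, x.1 = lam ∧ f - Φ x ∈ idealOf p := by
    intro lam hlam
    obtain ⟨q, hq, k, hk, hqk⟩ := Set.mem_add.1 hlam
    obtain ⟨σ, hσ, rfl⟩ := mem_truncQM_iff.1 hq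
    choose M hM hMσ using fun j => exists_gram_of_mem_sosDeg (he₂ j) (hσ j)
    refine ⟨(lam, M), hM, rfl, ?_⟩
    have : f - Φ (lam, M) = k + ∑ j, (σ j * weight g j - gram (e j) (M j) * weight g j) := by
      rw [hΦ, Finset.sum_sub_distrib]
      linear_combination -hqk
    rw [this]
    exact add_mem (truncIdeal_subset hk) (Ideal.sum_mem _ fun j _ => hMσ j)
  -- The degree count makes `htrunc` applicable: `f - Φ x` has degree at most `2t`, so plain
  -- membership in the ideal improves to membership in its truncation.
  have hdesc : ∀ x ∈ Cone, f - Φ x ∈ idealOf p → x.1 ∈ strFeasible p g h f t := by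
    intro x hx hxI
    have hsos : ∀ j, gram (e j) (x.2 j) ∈ sosDeg n (2 * multDeg g t j) := fun j =>
      gram_mem_sosDeg (he₁ j) (hx j)
    refine Set.mem_add.2 ⟨∑ j, gram (e j) (x.2 j) * weight g j, mem_truncQM_iff.2 ⟨_, hsos, rfl⟩,
      f - Φ x, htrunc _ hxI ?_, ?_⟩
    · refine (totalDegree_sub _ _).trans (max_le (totalDegree_le_of_halfDeg_le hft) ?_)
      rw [hΦ]
      refine (totalDegree_add _ _).trans (max_le ?_ ?_)
      · refine totalDegree_finsetSum_le fun i _ => (totalDegree_mul _ _).trans ?_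
        rw [totalDegree_C, zero_add]
        exact totalDegree_le_of_halfDeg_le (hht i)
      · exact totalDegree_finsetSum_le fun j _ => totalDegree_mul_weight_le hgt j (hsos j).2
    · rw [hΦ]; ring
  obtain ⟨x₀, hx₀, hx₀I⟩ : ∃ x₀ ∈ Cone, f - Φ x₀ ∈ idealOf p := by
    obtain ⟨N, hN⟩ := mem_boundedBelow (g := g) hR hball (totalDegree_le_of_halfDeg_le hft)
    -- As `h i₀ = 1`, this `λ` turns `f - ∑ λᵢhᵢ` into `f + N`.
    obtain ⟨x, hx, -, hxI⟩ := hlift (Pi.single i₀ (-N)) (Set.mem_add.2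
      ⟨C N + f, hN, 0, ⟨0, by simp, by simp⟩, by
        rw [Finset.sum_eq_single i₀ (by intro i _ hi; simp [hi]) (by simp)]
        simp [hh, add_comm]⟩)
    exact ⟨x, hx, hxI⟩
  have hweight : ∀ j, ∀ x ∈ semialgSet p g, 0 ≤ eval x (weight g j) := by
    intro j x hx
    cases j with
    | none => simp [weight]
    | some j => exact hx.2 j
  obtain ⟨x, hx, hxK, hmax⟩ := Conic.exists_max_of_recession hclosed
    (fun x hx y hy j => add_mem_psd (hx j) (hy j))
    (fun a ha x hx j => smul_mem_psd ha (hx j)) K c hx₀ (by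
      intro x hx hxK
      have hsum : ∀ y ∈ semialgSet p g, ∑ i, x.1 i * eval y (h i) +
          ∑ j, eval y (gram (e j) (x.2 j)) * eval y (weight g j) = 0 := by
        intro y hy
        have := eval_eq_zero_of_mem_idealOf hxK (x := y) hy.1
        simpa [hΦ] using this
      have hterm : ∀ y ∈ semialgSet p g, ∀ j,
          0 ≤ eval y (gram (e j) (x.2 j)) * eval y (weight g j) := fun y hy j =>
        mul_nonneg (eval_gram_nonneg _ (hx j) y) (hweight j y hy)
      have hnonpos : ∀ y ∈ semialgSet p g, ∑ i, x.1 i * eval y (h i) ≤ 0 := by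
        intro y hy
        have h1 := hsum y hy
        have h2 := Finset.sum_nonneg fun j (_ : j ∈ Finset.univ) => hterm y hy j
        linarith
      refine ⟨sum_mul_nonpos_of_mem_momentCone hbdd (intrinsicInterior_subset hb) hnonpos,
        fun hcx => ?_⟩
      -- Nonnegative terms summing to zero on `X` vanish there one by one, and so does each
      -- polynomial being squared, times the weight. That product lies in the ideal by `hvanish`,
      -- and independence in the reduced basis kills its coefficients.
      have hzero : ∀ j, x.2 j = 0 := by
        intro j
        have hgram : ∀ y ∈ semialgSet p g,
            eval y (gram (e j) (x.2 j)) * eval y (weight g j) = 0 := by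
          intro y hy
          have h1 := hsum y hy
          rw [sum_eq_zero_of_mem_intrinsicInterior hbdd hb hnonpos hcx hy, zero_add] at h1
          exact (Finset.sum_eq_zero_iff_of_nonneg fun j _ => hterm y hy j).1 h1 j
            (Finset.mem_univ j)
        obtain ⟨k, v, hv, hgv⟩ := exists_sum_sq_of_mem_psd (e j) (hx j)
        have hv0 : ∀ a, v a = 0 := by
          intro a
          refine he₃ j (v a) (hvanish _ fun y hy => ?_)
          have h1 := hgram y hy
          rw [hgv, map_sum] at h1
          rw [map_mul]
          rcases mul_eq_zero.1 h1 with h1 | h1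
          · have h2 := (Finset.sum_eq_zero_iff_of_nonneg fun a _ => by
              rw [map_pow]; exact sq_nonneg _).1 h1 a (Finset.mem_univ a)
            rw [map_pow, sq_eq_zero_iff] at h2
            rw [h2, zero_mul]
          · rw [h1, mul_zero]
        rw [hv]
        simp only [hv0]
        ext; simp
      intro j
      -- The cone does not constrain `λ`, so reversibility concerns the Gram part alone.
      change -(x.2 j) ∈ psd (r j)
      rw [hzero j, neg_zero]
      exact zero_mem_psd)
  have hxI : f - Φ x ∈ idealOf p := by
    have h1 : Φ (x - x₀) ∈ idealOf p := hxK
    rw [map_sub] at h1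
    have : f - Φ x = (f - Φ x₀) - (Φ x - Φ x₀) := by ring
    rw [this]
    exact sub_mem hx₀I h1
  refine ⟨x.1, hdesc x hx hxI, fun lam hlam => ?_⟩
  obtain ⟨y, hy, rfl, hyI⟩ := hlift lam hlam
  refine hmax y hy ((hK _).2 ?_)
  rw [map_sub]
  have : Φ y - Φ x₀ = (f - Φ x₀) - (f - Φ y) := by ring
  rw [this]
  exact sub_mem hx₀I hyI

end Attainment

end GMP

end

theorem theorem1p2 {n m s ℓ : ℕ} [NeZero m] [NeZero ℓ]
    (p : Fin s → GMP.Poly n) (g : Fin ℓ → GMP.Poly n) (h : Fin m → GMP.Poly n)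
    (f : GMP.Poly n) (b : Fin m → ℝ)
    (R : ℝ) (hR : 0 < R) (hball : g 0 = GMP.ballPoly n R)
    (hX :
      (ℓ = 1 ∧ GMP.realVariety p ⊆ {x | 0 < MvPolynomial.eval x (GMP.ballPoly n R)} ∧
        GMP.IsRealRadical (GMP.idealOf p) ∧ GMP.IsGrlexGroebner p) ∨
      ((∀ l, p l = 0) ∧ (interior (GMP.semialgSet p g)).Nonempty))
    (hh : h 0 = 1) (hb : 0 < b 0)
    (hrel : b ∈ intrinsicInterior ℝ (GMP.momentCone (GMP.semialgSet p g) h))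
    (t : ℕ) (ht : GMP.tMin p g h f ≤ t) :
    ∃ lam ∈ GMP.strFeasible p g h f t,
      IsMaxOn (fun l : Fin m → ℝ => ∑ i, b i * l i) (GMP.strFeasible p g h f t) lam := by
  simp only [GMP.tMin, sup_le_iff, Finset.sup_le_iff, Finset.mem_univ, true_implies] at ht
  obtain ⟨⟨⟨hgt, -⟩, hht⟩, hft⟩ := ht
  rcases hX with ⟨rfl, hV, hI, hG⟩ | ⟨hp, hint⟩
  · refine GMP.exists_isMaxOn hR hball hh (fun k hk => ?_)
      (fun k hk hdeg => GMP.mem_truncIdeal_of_groebner hG hk hdeg) hrel hgt hht hft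
    -- The ball is the only inequality and holds on the whole real variety, which therefore equals
    -- `X`.
    refine RealAlg.mem_of_isRealRadical hI fun x hx => hk x ⟨hx, fun j => ?_⟩
    have hj : j = 0 := Subsingleton.elim _ _
    rw [hj, hball]
    exact (hV hx).le
  · have hI : ∀ k, k ∈ GMP.idealOf p → k = 0 := by
      intro k hk
      have : GMP.idealOf p ≤ ⊥ := by
        rw [GMP.idealOf, Ideal.span_le]
        rintro _ ⟨l, rfl⟩
        exact hp l
      exact this hk
    refine GMP.exists_isMaxOn hR hball hh (fun k hk => ?_) (fun k hk _ => ?_) hrel hgt hht hft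
    · rw [GMP.eq_zero_of_interior_nonempty hint hk]
      exact zero_mem _
    · rw [hI k hk]
      exact ⟨0, by simp, by simp⟩
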